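/- A spherical Lambert cube $L(a,b,c)$ is a convex polytope in the unit sphere $\mathbb S^3\subset\mathbb R^4$ of the combinatorial type of a cube, whose dihedral angles along three pairwise disjoint edges, no two of which are parallel in the combinatorial cube, are $a,b,c$ (the essential angles), and whose other nine dihedral angles are all equal to $\pi/2$. Among the spherical Lambert cubes $L(a,b,c)$ with $a,b,c\in\pi\mathbb Q$ and $\cos^2 a+\cos^2 b+\cos^2 c=1$ there are, up to permutation of the essential angles and up to isometry of $\mathbb S^3$, exactly two: $$L_1=L\left(\tfrac{3\pi}{4},\tfrac{2\pi}{3},\tfrac{2\pi}{3}\right),\qquad L_2=L\left(\tfrac{2\pi}{3},\tfrac{3\pi}{5},\tfrac{4\pi}{5}\right).$$ Both exist, they are not isometric, and their volumes are $\operatorname{Vol}L_1=\tfrac{31}{576}\pi^2$ and $\operatorname{Vol}L_2=\tfrac{17}{360}\pi^2$, where $\operatorname{Vol}\mathbb S^3=2\pi^2$. In particular there is no nonconstant continuous family of such cubes: if $t\mapsto(a(t),b(t),c(t))$ is continuous on an interval $[t_0,t_1]$, $t_0<t_1$, and for every $t\in[t_0,t_1]\cap\pi\mathbb Q$ there is a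 spherical Lambert cube $L(a(t),b(t),c(t))$ with $a(t),b(t),c(t)\in\pi\mathbb Q$ and $\cos^2a(t)+\cos^2b(t)+\cos^2c(t)=1$, then $(a(t),b(t),c(t))$ is constant on $[t_0,t_1]$. -/

import Mathlib

open MeasureTheory

/-- The set of labels of the six facets of the combinatorial cube `[-1, 1]³`: the label `(i, true)`
stands for the facet `xᵢ = 1` and `(i, false)` for the opposite facet `xᵢ = -1`. -/
abbrev CubeFacet : Type := Fin 3 × Bool

/-- The intersection of the unit sphere `S³ ⊂ ℝ⁴` with the polyhedral cone whose outward normals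
are the vectors `u f`. -/
def sphericalPolyhedron (u : CubeFacet → EuclideanSpace ℝ (Fin 4)) :
    Set (EuclideanSpace ℝ (Fin 4)) :=
  {x | x ∈ Metric.sphere (0 : EuclideanSpace ℝ (Fin 4)) 1 ∧ ∀ f, inner ℝ (u f) x ≤ 0}

/-- The face of `sphericalPolyhedron u` cut out by the bounding hyperplanes with label in `S`. -/
def sphericalFace (u : CubeFacet → EuclideanSpace ℝ (Fin 4)) (S : Set CubeFacet) :
    Set (EuclideanSpace ℝ (Fin 4)) :=
  {x | x ∈ sphericalPolyhedron u ∧ ∀ f ∈ S, inner ℝ (u f) x = 0}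

/-- `P ⊂ S³` is a spherical polytope of the combinatorial type of a cube, with outward unit facet
normals `u`: a collection of facets of `P` has a common point if and only if the corresponding
facets of the standard cube have a common vertex (the vertices of the standard cube are the sign
vectors `ε`, and the facets through `ε` are the `(i, ε i)`).

This condition says that `P` has the face lattice of a cube. The bounding hyperplanes
through a vertex of `P` are then exactly three, one from each opposite pair, and every such choice
gives exactly one vertex. It also contains nondegeneracy: opposite facets being nonempty and
disjoint, no bounding hyperplane contains `P`, so `P` has nonempty interior in `S³`; and `P`
contains no pair of antipodal points, as these would lie on all six facets. -/
structure IsSphericalCube (u : CubeFacet → EuclideanSpace ℝ (Fin 4))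
    (P : Set (EuclideanSpace ℝ (Fin 4))) : Prop where
  norm_normal : ∀ f, ‖u f‖ = 1
  eq_polyhedron : P = sphericalPolyhedron u
  face_nonempty_iff : ∀ S : Set CubeFacet,
    (sphericalFace u S).Nonempty ↔ ∃ ε : Fin 3 → Bool, ∀ f ∈ S, ε f.1 = f.2

/-- The interior dihedral angle between two facets with given outward normals. -/
noncomputable def dihedralAngle (n m : EuclideanSpace ℝ (Fin 4)) : ℝ :=
  Real.pi - InnerProductGeometry.angle n m

/-- `P` is a spherical Lambert cube `L(a, b, c)`: a spherical polytope of the combinatorial type of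
a cube, with dihedral angles `a`, `b`, `c` (the essential angles) along three pairwise disjoint
edges, no two of them parallel in the standard cube, and dihedral angle `π / 2` along the other
nine edges. The essential edges are those where the facets `xᵢ = 1` and `xᵢ₊₁ = -1` meet, with
`i` modulo `3`; all other choices of such a triple of edges arise from this one by relabelling. -/
def IsLambertCube (a b c : ℝ) (P : Set (EuclideanSpace ℝ (Fin 4))) : Prop :=
  ∃ u : CubeFacet → EuclideanSpace ℝ (Fin 4), IsSphericalCube u P ∧
    ∀ (i : Fin 3) (s t : Bool), dihedralAngle (u (i, s)) (u (i + 1, t)) =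
      if s = true ∧ t = false then ![a, b, c] i else Real.pi / 2

/-- An angle is rational if it is a rational multiple of `π`. -/
def IsRationalAngle (x : ℝ) : Prop := ∃ q : ℚ, x = q * Real.pi

/-- `P` is a spherical Lambert cube `L(a, b, c)` with rational essential angles such that
`cos² a + cos² b + cos² c = 1`. -/
def IsRationalPythagoreanLambertCube (a b c : ℝ) (P : Set (EuclideanSpace ℝ (Fin 4))) : Prop :=
  IsLambertCube a b c P ∧ IsRationalAngle a ∧ IsRationalAngle b ∧ IsRationalAngle c ∧
    Real.cos a ^ 2 + Real.cos b ^ 2 + Real.cos c ^ 2 = 1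

/-- Congruence by an isometry of `S³`, that is, by an orthogonal transformation of `ℝ⁴`. -/
def SphericallyCongruent (P Q : Set (EuclideanSpace ℝ (Fin 4))) : Prop :=
  ∃ g : EuclideanSpace ℝ (Fin 4) ≃ₗᵢ[ℝ] EuclideanSpace ℝ (Fin 4), g '' P = Q

/-- The three-dimensional volume of `P ⊂ S³`, for the standard surface measure on the unit sphere
(of total mass `2π²`). -/
noncomputable def sphericalVolume (P : Set (EuclideanSpace ℝ (Fin 4))) : ENNReal :=
  (volume : Measure (EuclideanSpace ℝ (Fin 4))).toSphere (Subtype.val ⁻¹' P)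

/-! Arithmetic. The condition on the squared cosines says that 2cos 2a + 2cos 2b + 2cos 2c = -2, a
relation between roots of unity. The normalized trace over ℚ of a primitive n-th root of unity is
μ(n)/φ(n), so the three values μ/φ attached to the doubled angles add up to -1. Obtuse angles give n
> 2, and then μ(n)/φ(n) is -1/2 for n = 3, -1/4 for n = 5, and at least -1/6 otherwise. Only -1/2,
-1/2, 0 and -1/2, -1/4, -1/4 reach -1, which yields the two triples (`obtuse_rational_angles_eq`).

Geometry. Put α = -cos a, β = -cos b, γ = -cos c. At the vertex common to the three `false` facets,
their inward normals and the vertex itself form an orthonormal frame. In this frame the Gram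
relations, the signs at the neighbouring vertices and α² + β² + γ² = 1 determine the remaining
normals and force α, β, γ > 0 (`IsLambertCube.congruent_lambertNormal`). So the essential angles are
obtuse and the cube is unique up to congruence; conversely `lambertNormal` realizes it.

Volume. Let J be multiplication by the imaginary unit quaternion with components α, β, γ. The cone
over the standard cube is O ∩ J⁻¹O, where O is given by x₀, x₁, x₂ ≥ 0. Since J² = -1, the signs (s,
t) of the coordinates of x and Jx become (t, -s) under J. Summed over this orbit of length four, the
indicator of the cone becomes a sum of products of signs (`octant_sum_eq`). The quadruple products
involve pairs of forms in orthogonal planes, so their ball integrals factor into circle means, which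
are linear in the angles. Hence the volume is (π²/2 - (π - a)² - (π - b)² - (π - c)²)/4, which also
separates the two cubes. Rigidity of families holds because a continuous curve with values in a
finite set at a dense set of times is constant. -/

/-! ### Normalized traces of roots of unity -/

open Polynomial in
theorem nextCoeff_cyclotomic_int {n : ℕ} (hn : 0 < n) :
    (cyclotomic n ℤ).nextCoeff = -ArithmeticFunction.moebius n := by
  induction n using Nat.strong_induction_on with
  | _ n ih =>
    -- Second coefficients of monic polynomials add under multiplication. In ∏ Φ_d = Xⁿ - 1 they sum
    -- to -[n = 1], which is minus the divisor sum of μ.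
    have h1 : ∑ d ∈ n.divisors, (cyclotomic d ℤ).nextCoeff = -∑ d ∈ n.divisors,
        ArithmeticFunction.moebius d := by
      rw [← Polynomial.Monic.nextCoeff_prod _ _ (fun i _ => cyclotomic.monic i ℤ),
        prod_cyclotomic_eq_X_pow_sub_one hn]
      have h2 := DFunLike.congr_fun ArithmeticFunction.moebius_mul_coe_zeta n
      rw [ArithmeticFunction.coe_mul_zeta_apply] at h2
      rw [h2]
      have hd : (X ^ n - 1 : ℤ[X]).natDegree = n := by
        simpa using natDegree_X_pow_sub_C (R := ℤ) (n := n) (r := 1)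
      rw [nextCoeff_of_natDegree_pos (by omega), hd]
      rcases Nat.lt_or_ge 1 n with h | h
      · rw [ArithmeticFunction.one_apply_ne (by omega)]
        simp [coeff_X_pow, coeff_one, show n - 1 ≠ n by omega, show n - 1 ≠ 0 by omega]
      · obtain rfl : n = 1 := by omega
        simp
    rw [← Nat.insert_self_properDivisors hn.ne',
      Finset.sum_insert Nat.self_notMem_properDivisors,
      Finset.sum_insert Nat.self_notMem_properDivisors] at h1
    have h3 : ∑ d ∈ n.properDivisors, (cyclotomic d ℤ).nextCoeff =
        -∑ d ∈ n.properDivisors, ArithmeticFunction.moebius d := by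
      rw [← Finset.sum_neg_distrib]
      refine Finset.sum_congr rfl fun d hd => ?_
      have := Nat.mem_properDivisors.1 hd
      exact ih d this.2 (Nat.pos_of_dvd_of_pos this.1 hn)
    linarith

/-- The normalized trace of a root of unity of order `n` is `μ(n) / φ(n)`. -/
theorem IsPrimitiveRoot.normalizedTrace_eq {K : Type*} [Field K] [CharZero K] [Algebra ℚ K]
    [Algebra.IsIntegral ℚ K] {ζ : K} {n : ℕ} (hn : 0 < n) (h : IsPrimitiveRoot ζ n) :
    Algebra.normalizedTrace ℚ K ζ = (ArithmeticFunction.moebius n : ℚ) / n.totient := by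
  -- The cyclotomic minimal polynomial uses the canonical ℚ-algebra structure; all such structures
  -- agree.
  obtain rfl := Subsingleton.elim ‹Algebra ℚ K› DivisionRing.toRatAlgebra
  rw [Algebra.normalizedTrace_minpoly, ← Polynomial.cyclotomic_eq_minpoly_rat h hn,
    Polynomial.natDegree_cyclotomic, ← Polynomial.map_cyclotomic_int,
    Polynomial.nextCoeff_map (RingHom.injective_int _), nextCoeff_cyclotomic_int hn]
  simp [div_eq_inv_mul]

/-- As μ ≥ -1, a value below -1/6 needs n squarefree with φ(n) < 6. Since φ(n) is even it is 2 or 4,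
so every prime p dividing n has p - 1 ∣ 4, and n divides 30. -/
theorem moebius_div_totient_cases {n : ℕ} (hn : 2 < n) :
    n = 3 ∨ n = 5 ∨ -(1 / 6 : ℚ) ≤ (ArithmeticFunction.moebius n : ℚ) / n.totient := by
  have he := Nat.totient_even hn
  have hpos : 0 < n.totient := Nat.totient_pos.2 (by omega)
  by_cases hs : Squarefree n
  swap
  · right; right
    rw [ArithmeticFunction.moebius_eq_zero_of_not_squarefree hs]; norm_num
  by_cases h6 : 6 ≤ n.totient
  · right; right
    have h1 : (-1 : ℚ) ≤ ArithmeticFunction.moebius n := by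
      exact_mod_cast (abs_le.1 (ArithmeticFunction.abs_moebius_le_one (n := n))).1
    have h2 : (6 : ℚ) ≤ n.totient := by exact_mod_cast h6
    rw [le_div_iff₀ (by linarith)]
    linarith
  have h30 : n ∣ 30 := by
    rw [← Nat.prod_primeFactors_of_squarefree hs]
    have : n.primeFactors ⊆ ({2, 3, 5} : Finset ℕ) := by
      intro p hp
      have hpp := Nat.prime_of_mem_primeFactors hp
      have hd : p - 1 ∣ n.totient := by
        rw [← Nat.totient_prime hpp]
        exact Nat.totient_dvd_of_dvd (Nat.dvd_of_mem_primeFactors hp)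
      have h24 : n.totient = 2 ∨ n.totient = 4 := by
        obtain ⟨k, hk⟩ := he; omega
      have hd4 : p - 1 ∣ 4 := by
        rcases h24 with h | h <;> rw [h] at hd
        · exact hd.trans (by norm_num)
        · exact hd
      have hle := Nat.le_of_dvd (by norm_num) hd4
      have : p ≤ 5 := by omega
      interval_cases p <;> simp_all (decide := true)
    exact (Finset.prod_dvd_prod_of_subset _ _ _ this).trans (by decide)
  have hle : n ≤ 30 := Nat.le_of_dvd (by norm_num) h30
  have hmem : n ∈ Nat.divisors 30 := Nat.mem_divisors.2 ⟨h30, by norm_num⟩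
  have hdiv : Nat.divisors 30 = {1, 2, 3, 5, 6, 10, 15, 30} := by decide +kernel
  rw [hdiv] at hmem
  simp only [Finset.mem_insert, Finset.mem_singleton] at hmem
  have m6 : ArithmeticFunction.moebius 6 = 1 := by
    rw [show 6 = 2 * 3 by rfl, ArithmeticFunction.isMultiplicative_moebius.map_mul_of_coprime (by norm_num),
      ArithmeticFunction.moebius_apply_prime (by norm_num), ArithmeticFunction.moebius_apply_prime (by norm_num)]
    norm_num
  have m10 : ArithmeticFunction.moebius 10 = 1 := by
    rw [show 10 = 2 * 5 by rfl, ArithmeticFunction.isMultiplicative_moebius.map_mul_of_coprime (by norm_num),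
      ArithmeticFunction.moebius_apply_prime (by norm_num), ArithmeticFunction.moebius_apply_prime (by norm_num)]
    norm_num
  have t15 : Nat.totient 15 = 8 := by decide +kernel
  have t30 : Nat.totient 30 = 8 := by decide +kernel
  rcases hmem with rfl | rfl | rfl | rfl | rfl | rfl | rfl | rfl
  · omega
  · omega
  · simp
  · simp
  · right; right; rw [m6]; exact le_trans (by norm_num) (show (0 : ℚ) ≤ _ by positivity)
  · right; right; rw [m10]; exact le_trans (by norm_num) (show (0 : ℚ) ≤ _ by positivity)
  · omega
  · omega

/-! ### Rational angles with cosine squares summing to one -/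

theorem IsRationalAngle.exists_exp_pow_eq_one {a : ℝ} (ha : IsRationalAngle a) :
    ∃ n : ℕ, 0 < n ∧ Complex.exp ((2 * a : ℝ) * Complex.I) ^ n = 1 := by
  obtain ⟨q, rfl⟩ := ha
  refine ⟨q.den, q.den_pos, ?_⟩
  rw [← Complex.exp_nat_mul, Complex.exp_eq_one_iff]
  refine ⟨q.num, ?_⟩
  have hq : (q : ℂ) * q.den = q.num := by exact_mod_cast Rat.mul_den_eq_num q
  push_cast
  linear_combination (2 * (Real.pi : ℂ) * Complex.I) * hq

theorem exists_int_of_exp_pow_eq_one {a : ℝ} {n : ℕ}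
    (h : Complex.exp ((2 * a : ℝ) * Complex.I) ^ n = 1) : ∃ k : ℤ, n * a = k * Real.pi := by
  rw [← Complex.exp_nat_mul, Complex.exp_eq_one_iff] at h
  obtain ⟨k, hk⟩ := h
  refine ⟨k, ?_⟩
  have : ((n * a : ℝ) : ℂ) = ((k * Real.pi : ℝ) : ℂ) := by
    have h2 : (2 * Complex.I) ≠ 0 := by simp
    apply mul_left_cancel₀ h2
    push_cast at hk ⊢
    linear_combination hk
  exact_mod_cast this

/-- Transfers integrality from the intermediate-field ℚ-algebra structure to the canonical one. -/
instance isIntegral_rat_algebraicClosure : Algebra.IsIntegral ℚ (algebraicClosure ℚ ℂ) := by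
  have h := (algebraicClosure.isAlgebraic ℚ ℂ).isIntegral
  rw [Subsingleton.elim DivisionRing.toRatAlgebra (algebraicClosure ℚ ℂ).algebra']
  exact h

theorem IsRationalAngle.exists_isPrimitiveRoot {a : ℝ} (ha : IsRationalAngle a) :
    ∃ (n : ℕ) (ζ : algebraicClosure ℚ ℂ), 0 < n ∧ IsPrimitiveRoot ζ n ∧
      (ζ : ℂ) = Complex.exp ((2 * a : ℝ) * Complex.I) := by
  obtain ⟨n, hn, h⟩ := ha.exists_exp_pow_eq_one
  have hint : IsIntegral ℚ (Complex.exp ((2 * a : ℝ) * Complex.I)) :=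
    IsIntegral.of_pow hn (by rw [h]; exact isIntegral_one)
  let ζ : algebraicClosure ℚ ℂ := ⟨_, mem_algebraicClosure_iff.2 hint.isAlgebraic⟩
  have hζ : ζ ^ n = 1 := Subtype.ext (by simpa [ζ] using h)
  exact ⟨orderOf ζ, ζ, (isOfFinOrder_iff_pow_eq_one.2 ⟨n, hn, hζ⟩).orderOf_pos,
    IsPrimitiveRoot.orderOf ζ, rfl⟩

/-- For a rational angle `a`, the double angle `2a` has an order `n` modulo `2π`, and `2 cos 2a` is an
algebraic number of normalized trace `2μ(n) / φ(n)`. -/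
theorem IsRationalAngle.exists_order {a : ℝ} (ha : IsRationalAngle a) :
    ∃ (n : ℕ) (x : algebraicClosure ℚ ℂ), 0 < n ∧ (∃ k : ℤ, n * a = k * Real.pi) ∧
      (x : ℂ) = ((2 * Real.cos (2 * a) : ℝ) : ℂ) ∧
      Algebra.normalizedTrace ℚ (algebraicClosure ℚ ℂ) x =
        2 * ((ArithmeticFunction.moebius n : ℚ) / n.totient) := by
  obtain ⟨n, ζ, hn, hζ, h⟩ := ha.exists_isPrimitiveRoot
  refine ⟨n, ζ + ζ⁻¹, hn, exists_int_of_exp_pow_eq_one ?_, ?_, ?_⟩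
  · rw [← h]; exact congrArg Subtype.val hζ.pow_eq_one
  · push_cast
    rw [h, ← Complex.exp_neg, ← neg_mul, ← Complex.two_cos]
    push_cast
    rfl
  · rw [map_add, hζ.normalizedTrace_eq hn, hζ.inv.normalizedTrace_eq hn]
    ring

theorem eq_of_three_mul_eq {a : ℝ} (h0 : Real.pi / 2 < a) (h1 : a < Real.pi) {k : ℤ}
    (h : 3 * a = k * Real.pi) : a = 2 * Real.pi / 3 := by
  have hp := Real.pi_pos
  have h2 : (1 : ℝ) < k := by nlinarith
  have h3 : (k : ℝ) < 3 := by nlinarith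
  have h2' : 1 < k := by exact_mod_cast h2
  have h3' : k < 3 := by exact_mod_cast h3
  obtain rfl : k = 2 := by omega
  push_cast at h
  linarith

theorem eq_or_eq_of_five_mul_eq {a : ℝ} (h0 : Real.pi / 2 < a) (h1 : a < Real.pi) {k : ℤ}
    (h : 5 * a = k * Real.pi) : a = 3 * Real.pi / 5 ∨ a = 4 * Real.pi / 5 := by
  have hp := Real.pi_pos
  have h2 : (2 : ℝ) < k := by nlinarith
  have h3 : (k : ℝ) < 5 := by nlinarith
  have h2' : 2 < k := by exact_mod_cast h2
  have h3' : k < 5 := by exact_mod_cast h3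
  obtain rfl | rfl : k = 3 ∨ k = 4 := by omega
  · left; push_cast at h; linarith
  · right; push_cast at h; linarith

theorem cos_two_pi_div_three : Real.cos (2 * Real.pi / 3) = -(1 / 2) := by
  rw [show 2 * Real.pi / 3 = Real.pi - Real.pi / 3 by ring, Real.cos_pi_sub, Real.cos_pi_div_three]

theorem cos_three_pi_div_four : Real.cos (3 * Real.pi / 4) = -(√2 / 2) := by
  rw [show 3 * Real.pi / 4 = Real.pi - Real.pi / 4 by ring, Real.cos_pi_sub, Real.cos_pi_div_four]

theorem cos_four_pi_div_five : Real.cos (4 * Real.pi / 5) = -((√5 + 1) / 4) := by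
  rw [show 4 * Real.pi / 5 = Real.pi - Real.pi / 5 by ring, Real.cos_pi_sub, Real.cos_pi_div_five]
  ring

theorem cos_three_pi_div_five : Real.cos (3 * Real.pi / 5) = -((√5 - 1) / 4) := by
  rw [show 3 * Real.pi / 5 = Real.pi - 2 * (Real.pi / 5) by ring, Real.cos_pi_sub, Real.cos_two_mul,
    Real.cos_pi_div_five]
  have : √5 ^ 2 = 5 := Real.sq_sqrt (by norm_num)
  linear_combination (-1 / 8) * this

/-- Needed because order 2 has μ/φ = -1, which would break the trace bound. -/
theorem two_lt_of_mul_eq_pi_multiple {a : ℝ} (h0 : Real.pi / 2 < a) (h1 : a < Real.pi) {n : ℕ}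
    (hn : 0 < n) {k : ℤ} (h : n * a = k * Real.pi) : 2 < n := by
  by_contra hlt
  have hp := Real.pi_pos
  obtain rfl | rfl : n = 1 ∨ n = 2 := by omega
  · push_cast at h
    have h2 : (0 : ℝ) < k := by nlinarith
    have h3 : (k : ℝ) < 1 := by nlinarith
    have h2' : 0 < k := by exact_mod_cast h2
    have h3' : k < 1 := by exact_mod_cast h3
    omega
  · push_cast at h
    have h2 : (1 : ℝ) < k := by nlinarith
    have h3 : (k : ℝ) < 2 := by nlinarith
    have h2' : 1 < k := by exact_mod_cast h2
    have h3' : k < 2 := by exact_mod_cast h3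
    omega

/-- An obtuse rational angle has normalized trace `τ` of `cos 2a` equal to `-1/2` only for `2π/3`, to
`-1/4` only for `3π/5`, `4π/5`, and at least `-1/6` otherwise. -/
theorem IsRationalAngle.obtuse_cases {a : ℝ} (ha : IsRationalAngle a) (h0 : Real.pi / 2 < a)
    (h1 : a < Real.pi) : ∃ (x : algebraicClosure ℚ ℂ) (τ : ℚ),
      (x : ℂ) = ((2 * Real.cos (2 * a) : ℝ) : ℂ) ∧
      Algebra.normalizedTrace ℚ (algebraicClosure ℚ ℂ) x = 2 * τ ∧
      ((a = 2 * Real.pi / 3 ∧ τ = -(1 / 2)) ∨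
        ((a = 3 * Real.pi / 5 ∨ a = 4 * Real.pi / 5) ∧ τ = -(1 / 4)) ∨ -(1 / 6) ≤ τ) := by
  obtain ⟨n, x, hn, ⟨k, hk⟩, hx, ht⟩ := ha.exists_order
  refine ⟨x, _, hx, ht, ?_⟩
  rcases moebius_div_totient_cases (two_lt_of_mul_eq_pi_multiple h0 h1 hn hk) with rfl | rfl | h
  · left
    refine ⟨eq_of_three_mul_eq h0 h1 (by exact_mod_cast hk), ?_⟩
    rw [ArithmeticFunction.moebius_apply_prime (by norm_num), Nat.totient_prime (by norm_num)]
    norm_num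
  · right; left
    refine ⟨eq_or_eq_of_five_mul_eq h0 h1 (by exact_mod_cast hk), ?_⟩
    rw [ArithmeticFunction.moebius_apply_prime (by norm_num), Nat.totient_prime (by norm_num)]
    norm_num
  · exact Or.inr (Or.inr h)

theorem pi_mul_three_div_four_of_cos_sq {a : ℝ} (h0 : Real.pi / 2 < a) (h1 : a < Real.pi)
    (h : Real.cos a ^ 2 = 1 / 2) : a = 3 * Real.pi / 4 := by
  have hp := Real.pi_pos
  have hneg : Real.cos a < 0 := Real.cos_neg_of_pi_div_two_lt_of_lt h0 (by linarith)
  apply Real.injOn_cos ⟨by linarith, h1.le⟩ ⟨by linarith, by linarith⟩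
  rw [cos_three_pi_div_four]
  have h2 : √2 ^ 2 = 2 := Real.sq_sqrt (by norm_num)
  have h3 : 0 < √2 := by positivity
  nlinarith

/-- The obtuse rational angles with `cos² a + cos² b + cos² c = 1`. -/
theorem obtuse_rational_angles_eq {a b c : ℝ} (ha : IsRationalAngle a) (hb : IsRationalAngle b)
    (hc : IsRationalAngle c) (ha0 : Real.pi / 2 < a) (ha1 : a < Real.pi)
    (hb0 : Real.pi / 2 < b) (hb1 : b < Real.pi) (hc0 : Real.pi / 2 < c) (hc1 : c < Real.pi)
    (h : Real.cos a ^ 2 + Real.cos b ^ 2 + Real.cos c ^ 2 = 1) :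
    ({a, b, c} : Multiset ℝ) = {3 * Real.pi / 4, 2 * Real.pi / 3, 2 * Real.pi / 3} ∨
    ({a, b, c} : Multiset ℝ) = {2 * Real.pi / 3, 3 * Real.pi / 5, 4 * Real.pi / 5} := by
  obtain ⟨x, r, hx, hr, hxa⟩ := ha.obtuse_cases ha0 ha1
  obtain ⟨y, s, hy, hs, hyb⟩ := hb.obtuse_cases hb0 hb1
  obtain ⟨z, t, hz, ht, hzc⟩ := hc.obtuse_cases hc0 hc1
  have hsum : x + y + z = algebraMap ℚ (algebraicClosure ℚ ℂ) (-2) := by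
    apply Subtype.ext
    have : ((x + y + z : algebraicClosure ℚ ℂ) : ℂ) = (x : ℂ) + y + z := rfl
    rw [this, hx, hy, hz]
    have h2 : 2 * Real.cos (2 * a) + 2 * Real.cos (2 * b) + 2 * Real.cos (2 * c) = -2 := by
      rw [Real.cos_two_mul, Real.cos_two_mul, Real.cos_two_mul]
      linarith
    rw [← Complex.ofReal_add, ← Complex.ofReal_add, h2]
    simp
    rfl
  have htr : r + s + t = -1 := by
    have := congrArg (Algebra.normalizedTrace ℚ (algebraicClosure ℚ ℂ)) hsum
    rw [map_add, map_add, hr, hs, ht, Algebra.normalizedTrace_algebraMap_apply,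
      Algebra.normalizedTrace_self_apply] at this
    linarith
  have c3 : Real.cos (2 * Real.pi / 3) ^ 2 = 1 / 4 := by rw [cos_two_pi_div_three]; norm_num
  have h5 : √5 ^ 2 = 5 := Real.sq_sqrt (by norm_num)
  have h5' : 2 < √5 := by rw [Real.lt_sqrt] <;> norm_num
  have h5'' : √5 < 3 := by rw [Real.sqrt_lt] <;> norm_num
  -- Equal choices of u and v would force √5 = 0.
  have pair : ∀ u v : ℝ, (u = 3 * Real.pi / 5 ∨ u = 4 * Real.pi / 5) →
      (v = 3 * Real.pi / 5 ∨ v = 4 * Real.pi / 5) → Real.cos u ^ 2 + Real.cos v ^ 2 = 3 / 4 →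
      ({u, v} : Multiset ℝ) = {3 * Real.pi / 5, 4 * Real.pi / 5} := by
    rintro u v (rfl | rfl) (rfl | rfl) huv
    · rw [cos_three_pi_div_five] at huv; nlinarith
    · rfl
    · exact Multiset.pair_comm _ _
    · rw [cos_four_pi_div_five] at huv; nlinarith
  have rot : ∀ u v w : ℝ, ({u, v, w} : Multiset ℝ) = {v, w, u} := fun u v w => by
    simp only [Multiset.insert_eq_cons, ← Multiset.singleton_add]
    abel
  -- Of the 27 combinations of traces, the sum -1 leaves six: two angles 2π/3 with a third of trace
  -- 0, or one 2π/3 with two angles of order 5, in each position.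
  rcases hxa with ⟨rfl, rfl⟩ | ⟨ha5, rfl⟩ | hr' <;> rcases hyb with ⟨rfl, rfl⟩ | ⟨hb5, rfl⟩ | hs' <;>
    rcases hzc with ⟨rfl, rfl⟩ | ⟨hc5, rfl⟩ | ht' <;> first | (exfalso; linarith) | skip
  · left
    rw [pi_mul_three_div_four_of_cos_sq hc0 hc1 (by linarith), rot, rot]
  · right
    rw [Multiset.insert_eq_cons, Multiset.insert_eq_cons (2 * Real.pi / 3)]
    rw [pair _ _ hb5 hc5 (by linarith)]
  · left
    rw [pi_mul_three_div_four_of_cos_sq hb0 hb1 (by linarith), rot]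
  · right
    rw [rot, Multiset.insert_eq_cons, Multiset.insert_eq_cons (2 * Real.pi / 3),
      pair _ _ hc5 ha5 (by linarith)]
  · right
    rw [rot, rot, Multiset.insert_eq_cons, Multiset.insert_eq_cons (2 * Real.pi / 3),
      pair _ _ ha5 hb5 (by linarith)]
  · left
    rw [pi_mul_three_div_four_of_cos_sq ha0 ha1 (by linarith)]

/-! ### The standard Lambert cube -/

/-- The outward normals of the standard Lambert cube whose essential angles have cosines `-α`, `-β`,
`-γ` with `α² + β² + γ² = 1`. -/
noncomputable def lambertNormal (α β γ : ℝ) (f : CubeFacet) : EuclideanSpace ℝ (Fin 4) :=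
  if f.2 then ![!₂[β, -α, 0, -γ], !₂[0, γ, -β, -α], !₂[-γ, 0, α, -β]] f.1
  else ![!₂[-1, 0, 0, 0], !₂[0, -1, 0, 0], !₂[0, 0, -1, 0]] f.1

theorem inner_vec_four (a b c d : ℝ) (x : EuclideanSpace ℝ (Fin 4)) :
    inner ℝ !₂[a, b, c, d] x = a * x 0 + b * x 1 + c * x 2 + d * x 3 := by
  simp [PiLp.inner_apply, Fin.sum_univ_four, mul_comm]

theorem norm_sq_four (x : EuclideanSpace ℝ (Fin 4)) :
    ‖x‖ ^ 2 = x 0 ^ 2 + x 1 ^ 2 + x 2 ^ 2 + x 3 ^ 2 := by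
  simp [EuclideanSpace.norm_sq_eq, Fin.sum_univ_four]

section
variable (α β γ : ℝ) (x : EuclideanSpace ℝ (Fin 4))

theorem inner_lambertNormal_zero_true :
    inner ℝ (lambertNormal α β γ (0, true)) x = β * x 0 - α * x 1 - γ * x 3 := by
  simp only [lambertNormal, if_true, Matrix.cons_val_zero, inner_vec_four]; ring

theorem inner_lambertNormal_one_true :
    inner ℝ (lambertNormal α β γ (1, true)) x = γ * x 1 - β * x 2 - α * x 3 := by
  simp only [lambertNormal, if_true, Matrix.cons_val_one, Matrix.cons_val_zero, inner_vec_four]; ring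

theorem inner_lambertNormal_two_true :
    inner ℝ (lambertNormal α β γ (2, true)) x = α * x 2 - γ * x 0 - β * x 3 := by
  simp only [lambertNormal, if_true, Matrix.cons_val, inner_vec_four]; ring

theorem inner_lambertNormal_zero_false :
    inner ℝ (lambertNormal α β γ (0, false)) x = - x 0 := by
  simp [lambertNormal, inner_vec_four]

theorem inner_lambertNormal_one_false :
    inner ℝ (lambertNormal α β γ (1, false)) x = - x 1 := by
  simp [lambertNormal, inner_vec_four]

theorem inner_lambertNormal_two_false :
    inner ℝ (lambertNormal α β γ (2, false)) x = - x 2 := by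
  simp [lambertNormal, inner_vec_four]

end

theorem forall_cubeFacet {p : CubeFacet → Prop} : (∀ f, p f) ↔
    (p (0, true) ∧ p (1, true) ∧ p (2, true)) ∧ p (0, false) ∧ p (1, false) ∧ p (2, false) := by
  constructor
  · intro h; exact ⟨⟨h _, h _, h _⟩, h _, h _, h _⟩
  · rintro ⟨⟨h0, h1, h2⟩, h3, h4, h5⟩ ⟨i, s⟩
    fin_cases i <;> cases s <;> assumption

theorem forall_inner_lambertNormal_nonpos {α β γ : ℝ} {x : EuclideanSpace ℝ (Fin 4)} :
    (∀ f, inner ℝ (lambertNormal α β γ f) x ≤ 0) ↔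
      (β * x 0 - α * x 1 - γ * x 3 ≤ 0 ∧ γ * x 1 - β * x 2 - α * x 3 ≤ 0 ∧
        α * x 2 - γ * x 0 - β * x 3 ≤ 0) ∧ 0 ≤ x 0 ∧ 0 ≤ x 1 ∧ 0 ≤ x 2 := by
  rw [forall_cubeFacet]
  simp only [inner_lambertNormal_zero_true, inner_lambertNormal_one_true,
    inner_lambertNormal_two_true, inner_lambertNormal_zero_false, inner_lambertNormal_one_false,
    inner_lambertNormal_two_false, Left.neg_nonpos_iff]

theorem sphericalFace_nonempty_of_ne_zero {u : CubeFacet → EuclideanSpace ℝ (Fin 4)}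
    {S : Set CubeFacet} {x : EuclideanSpace ℝ (Fin 4)} (hx : x ≠ 0)
    (h : ∀ f, inner ℝ (u f) x ≤ 0) (hS : ∀ f ∈ S, inner ℝ (u f) x = 0) :
    (sphericalFace u S).Nonempty := by
  refine ⟨‖x‖⁻¹ • x, ⟨?_, fun f => ?_⟩, fun f hf => ?_⟩
  · simp [norm_smul, inv_mul_cancel₀ (norm_ne_zero_iff.2 hx)]
  · rw [inner_smul_right]
    exact mul_nonpos_of_nonneg_of_nonpos (by positivity) (h f)
  · rw [inner_smul_right, hS f hf, mul_zero]

/-- Solving the three facet equations and clearing denominators gives a polynomial vector on the ray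
through each vertex; normalization is left to `sphericalFace_nonempty_of_ne_zero`. -/
theorem exists_vertex_lambertNormal {α β γ : ℝ} (hα : 0 < α) (hβ : 0 < β) (hγ : 0 < γ)
    (ε : Fin 3 → Bool) : ∃ x : EuclideanSpace ℝ (Fin 4), x ≠ 0 ∧
      (∀ f, inner ℝ (lambertNormal α β γ f) x ≤ 0) ∧
      ∀ i, inner ℝ (lambertNormal α β γ (i, ε i)) x = 0 := by
  suffices H : ∃ x0 x1 x2 x3 : ℝ, (x0 ≠ 0 ∨ x3 ≠ 0 ∨ x2 ≠ 0) ∧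
      ((β * x0 - α * x1 - γ * x3 ≤ 0 ∧ γ * x1 - β * x2 - α * x3 ≤ 0 ∧
        α * x2 - γ * x0 - β * x3 ≤ 0) ∧ 0 ≤ x0 ∧ 0 ≤ x1 ∧ 0 ≤ x2) ∧
      (if ε 0 then β * x0 - α * x1 - γ * x3 else x0) = 0 ∧
      (if ε 1 then γ * x1 - β * x2 - α * x3 else x1) = 0 ∧
      (if ε 2 then α * x2 - γ * x0 - β * x3 else x2) = 0 by
    obtain ⟨x0, x1, x2, x3, hne, hle, h0, h1, h2⟩ := H
    refine ⟨!₂[x0, x1, x2, x3], ?_, ?_, ?_⟩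
    · intro h
      have e0 := congrArg (fun y : EuclideanSpace ℝ (Fin 4) => y 0) h
      have e2 := congrArg (fun y : EuclideanSpace ℝ (Fin 4) => y 2) h
      have e3 := congrArg (fun y : EuclideanSpace ℝ (Fin 4) => y 3) h
      simp at e0 e2 e3
      tauto
    · rw [forall_inner_lambertNormal_nonpos]
      simpa using hle
    · intro i
      fin_cases i
      · change inner ℝ (lambertNormal α β γ (0, ε 0)) _ = 0
        cases h : ε 0 <;> rw [h] at h0
        · rw [inner_lambertNormal_zero_false]; simpa using h0
        · rw [inner_lambertNormal_zero_true]; simpa using h0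
      · change inner ℝ (lambertNormal α β γ (1, ε 1)) _ = 0
        cases h : ε 1 <;> rw [h] at h1
        · rw [inner_lambertNormal_one_false]; simpa using h1
        · rw [inner_lambertNormal_one_true]; simpa using h1
      · change inner ℝ (lambertNormal α β γ (2, ε 2)) _ = 0
        cases h : ε 2 <;> rw [h] at h2
        · rw [inner_lambertNormal_two_false]; simpa using h2
        · rw [inner_lambertNormal_two_true]; simpa using h2
  cases ε 0 <;> cases ε 1 <;> cases ε 2 <;> simp only [if_true, if_false, Bool.false_eq_true]
  case' false.false.false => refine ⟨0, 0, 0, 1, Or.inr (Or.inl one_ne_zero), ?_⟩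
  case' false.false.true => refine ⟨0, 0, β, α, Or.inr (Or.inl hα.ne'), ?_⟩
  case' false.true.false => refine ⟨0, α, 0, γ, Or.inr (Or.inl hγ.ne'), ?_⟩
  case' false.true.true => refine ⟨0, α ^ 2 + β ^ 2, β * γ, α * γ, Or.inr (Or.inl (by positivity)), ?_⟩
  case' true.false.false => refine ⟨γ, 0, 0, β, Or.inr (Or.inl hβ.ne'), ?_⟩
  case' true.false.true => refine ⟨γ * α, 0, β ^ 2 + γ ^ 2, β * α, Or.inr (Or.inl (by positivity)), ?_⟩
  case' true.true.false => refine ⟨γ ^ 2 + α ^ 2, α * β, 0, γ * β, Or.inr (Or.inl (by positivity)), ?_⟩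
  case' true.true.true => refine ⟨α, β, γ, 0, Or.inl hα.ne', ?_⟩
  all_goals refine ⟨⟨⟨?_, ?_, ?_⟩, ?_, ?_, ?_⟩, ?_, ?_, ?_⟩
  all_goals first
    | ring1
    | exact le_of_eq (by ring1)
    | positivity
    | (rw [← neg_nonneg]; ring_nf; positivity)

/-- Weighting the `true` facet forms 0, 1, 2 by -γ, -α, -β cancels x₀, x₁, x₂ and leaves (α² + β² +
γ²) x₃. -/
theorem nonneg_of_forall_inner_lambertNormal {α β γ : ℝ} (h1 : α ^ 2 + β ^ 2 + γ ^ 2 = 1)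
    {x : EuclideanSpace ℝ (Fin 4)} (hα : 0 < α) (hβ : 0 < β) (hγ : 0 < γ)
    (h : ∀ f, inner ℝ (lambertNormal α β γ f) x ≤ 0) : 0 ≤ x 3 := by
  obtain ⟨⟨p0, p1, p2⟩, -⟩ := forall_inner_lambertNormal_nonpos.1 h
  have e : x 3 = (α ^ 2 + β ^ 2 + γ ^ 2) * x 3 := by rw [h1, one_mul]
  have q0 := mul_nonneg hγ.le (neg_nonneg.2 p0)
  have q1 := mul_nonneg hα.le (neg_nonneg.2 p1)
  have q2 := mul_nonneg hβ.le (neg_nonneg.2 p2)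
  rw [e]
  linarith

/-- Opposite facets of the standard Lambert cube are disjoint. -/
theorem eq_zero_of_opposite_facets {α β γ x0 x1 x2 x3 : ℝ} (hα : 0 < α) (hγ : 0 < γ)
    (h0 : x0 = 0) (hp0 : β * x0 - α * x1 - γ * x3 = 0) (h1 : 0 ≤ x1) (h2 : 0 ≤ x2) (h3 : 0 ≤ x3)
    (hp2 : α * x2 - γ * x0 - β * x3 ≤ 0) : x1 = 0 ∧ x2 = 0 ∧ x3 = 0 := by
  subst h0
  have e1 := mul_nonneg hα.le h1
  have e3 := mul_nonneg hγ.le h3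
  have z1 : x1 = 0 := by
    have : α * x1 = 0 := by linarith
    simpa [hα.ne'] using this
  have z3 : x3 = 0 := by
    have : γ * x3 = 0 := by linarith
    simpa [hγ.ne'] using this
  subst z1 z3
  have e2 := mul_nonneg hα.le h2
  have : α * x2 = 0 := by linarith
  exact ⟨rfl, by simpa [hα.ne'] using this, rfl⟩

theorem isSphericalCube_lambertNormal {α β γ : ℝ} (hα : 0 < α) (hβ : 0 < β) (hγ : 0 < γ)
    (h1 : α ^ 2 + β ^ 2 + γ ^ 2 = 1) :
    IsSphericalCube (lambertNormal α β γ) (sphericalPolyhedron (lambertNormal α β γ)) where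
  norm_normal f := by
    rw [← sq_eq_sq₀ (norm_nonneg _) zero_le_one, norm_sq_four]
    revert f
    rw [forall_cubeFacet]
    simp only [lambertNormal]
    simp
    refine ⟨?_, ?_, ?_⟩ <;> linarith
  eq_polyhedron := rfl
  face_nonempty_iff S := by
    constructor
    · rintro ⟨x, ⟨hx, hle⟩, hS⟩
      have h3 := nonneg_of_forall_inner_lambertNormal h1 hα hβ hγ hle
      obtain ⟨⟨p0, p1, p2⟩, z0, z1, z2⟩ := forall_inner_lambertNormal_nonpos.1 hle
      have hx1 : x 0 ^ 2 + x 1 ^ 2 + x 2 ^ 2 + x 3 ^ 2 = 1 := by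
        rw [← norm_sq_four, mem_sphere_zero_iff_norm.1 hx, one_pow]
      have key : ∀ i, ¬ ((i, true) ∈ S ∧ (i, false) ∈ S) := by
        rintro i ⟨ht, hf⟩
        replace ht := hS _ ht
        replace hf := hS _ hf
        fin_cases i
        · simp only [Fin.zero_eta, inner_lambertNormal_zero_true,
            inner_lambertNormal_zero_false] at ht hf
          obtain ⟨e1, e2, e3⟩ := eq_zero_of_opposite_facets hα hγ (neg_eq_zero.1 hf) ht z1 z2 h3 p2
          rw [neg_eq_zero.1 hf, e1, e2, e3] at hx1; norm_num at hx1
        · simp only [Fin.mk_one, inner_lambertNormal_one_true,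
            inner_lambertNormal_one_false] at ht hf
          obtain ⟨e1, e2, e3⟩ := eq_zero_of_opposite_facets hβ hα (neg_eq_zero.1 hf) ht z2 z0 h3 p0
          rw [neg_eq_zero.1 hf, e1, e2, e3] at hx1; norm_num at hx1
        · simp only [Fin.reduceFinMk, inner_lambertNormal_two_true,
            inner_lambertNormal_two_false] at ht hf
          obtain ⟨e1, e2, e3⟩ := eq_zero_of_opposite_facets hγ hβ (neg_eq_zero.1 hf) ht z0 z1 h3 p1
          rw [neg_eq_zero.1 hf, e1, e2, e3] at hx1; norm_num at hx1
      classical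
      -- No opposite pair lies in S, so membership of the `true` facet decides the sign; pairs
      -- missing from S default to `false`.
      refine ⟨fun i => decide ((i, true) ∈ S), ?_⟩
      rintro ⟨i, s⟩ hf
      cases s
      · simpa using fun h => key i ⟨h, hf⟩
      · simpa using hf
    · rintro ⟨ε, hε⟩
      obtain ⟨x, hx, hle, h0⟩ := exists_vertex_lambertNormal hα hβ hγ ε
      refine sphericalFace_nonempty_of_ne_zero hx hle fun f hf => ?_
      rw [show f = (f.1, ε f.1) by rw [hε f hf]]
      exact h0 _

theorem dihedralAngle_eq_iff {n m : EuclideanSpace ℝ (Fin 4)} (hn : ‖n‖ = 1) (hm : ‖m‖ = 1)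
    {θ : ℝ} (h0 : 0 ≤ θ) (h1 : θ ≤ Real.pi) :
    dihedralAngle n m = θ ↔ inner ℝ n m = -Real.cos θ := by
  rw [dihedralAngle, InnerProductGeometry.angle, hn, hm, mul_one, div_one]
  constructor
  · rintro rfl
    have := abs_le.1 (abs_real_inner_le_norm n m)
    rw [hn, hm, mul_one] at this
    rw [Real.cos_pi_sub, Real.cos_arccos this.1 this.2, neg_neg]
  · intro h
    rw [h, Real.arccos_neg, Real.arccos_cos h0 h1]
    ring

theorem dihedralAngle_mem_Icc (n m : EuclideanSpace ℝ (Fin 4)) :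
    0 ≤ dihedralAngle n m ∧ dihedralAngle n m ≤ Real.pi := by
  have h0 := InnerProductGeometry.angle_nonneg n m
  have h1 := InnerProductGeometry.angle_le_pi n m
  constructor <;> rw [dihedralAngle] <;> linarith

/-- Existence of Lambert cubes with obtuse essential angles and `cos² a + cos² b + cos² c = 1`. -/
theorem isLambertCube_lambertNormal {a b c : ℝ} (ha : 0 ≤ a) (ha' : a ≤ Real.pi) (hb : 0 ≤ b)
    (hb' : b ≤ Real.pi) (hc : 0 ≤ c) (hc' : c ≤ Real.pi)
    (hca : Real.cos a < 0) (hcb : Real.cos b < 0) (hcc : Real.cos c < 0)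
    (h1 : Real.cos a ^ 2 + Real.cos b ^ 2 + Real.cos c ^ 2 = 1) :
    IsLambertCube a b c (sphericalPolyhedron
      (lambertNormal (-Real.cos a) (-Real.cos b) (-Real.cos c))) := by
  have hcube := isSphericalCube_lambertNormal (neg_pos.2 hca) (neg_pos.2 hcb) (neg_pos.2 hcc)
    (by simpa using h1)
  refine ⟨_, hcube, fun i s t => ?_⟩
  have hp := Real.pi_pos
  rw [dihedralAngle_eq_iff (hcube.norm_normal _) (hcube.norm_normal _)]
  · fin_cases i <;> cases s <;> cases t <;>
      simp [lambertNormal, inner_vec_four]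
    all_goals ring
  · fin_cases i <;> cases s <;> cases t <;> simp <;> linarith
  · fin_cases i <;> cases s <;> cases t <;> simp <;> linarith

/-! ### Rigidity of a Lambert cube from its Gram relations -/

section Uniqueness

variable {u : CubeFacet → EuclideanSpace ℝ (Fin 4)} {P : Set (EuclideanSpace ℝ (Fin 4))}

/-- Strictness comes from the face lattice: equality would put a point on two opposite facets. -/
theorem IsSphericalCube.exists_vertex (h : IsSphericalCube u P) (ε : Fin 3 → Bool) :
    ∃ x : EuclideanSpace ℝ (Fin 4), ‖x‖ = 1 ∧ (∀ i, inner ℝ (u (i, ε i)) x = 0) ∧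
      ∀ i, inner ℝ (u (i, !ε i)) x < 0 := by
  obtain ⟨x, ⟨hx, hle⟩, h0⟩ := (h.face_nonempty_iff {f | ε f.1 = f.2}).2 ⟨ε, fun f hf => hf⟩
  refine ⟨x, mem_sphere_zero_iff_norm.1 hx, fun i => h0 _ rfl, fun i => ?_⟩
  refine lt_of_le_of_ne (hle _) fun he => ?_
  obtain ⟨ε', hε'⟩ := (h.face_nonempty_iff {(i, ε i), (i, !ε i)}).1 ⟨x, ⟨hx, hle⟩, by
    rintro f (rfl | rfl)
    · exact h0 _ rfl
    · exact he⟩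
  have e1 : ε' i = ε i := hε' (i, ε i) (Or.inl rfl)
  have e2 : ε' i = !ε i := hε' (i, !ε i) (Or.inr rfl)
  rw [e1] at e2
  cases h : ε i <;> simp [h] at e2

theorem pos_of_neg_of_mul_neg {v k : ℝ} (hv : v < 0) (h : v * k < 0) : 0 < k := by nlinarith

theorem eq_neg_of_neg_of_sq_eq {v k : ℝ} (hv : v < 0) (hk : 0 < k) (h : v ^ 2 = k ^ 2) :
    v = -k := by
  rcases sq_eq_sq_iff_eq_or_eq_neg.1 h with h | h <;> linarith

/-- The equation at a neighbouring vertex gives x < 0, and the orthogonality relation says αx = -vw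
< 0. -/
theorem lambert_cos_pos {α x v w k m : ℝ} (h1 : 0 = α * x + v * w) (hv : v < 0) (hw : w < 0)
    (h2 : 0 = x * m + v * k) (hm : m < 0) (hk : 0 < k) : 0 < α := by
  have hx : x < 0 := by nlinarith
  nlinarith

/-- Each equation makes one squared unknown a decreasing function of another, with the expected
values as a solution. Around the cycle of three a deviation changes sign an odd number of times and
contradicts itself. -/
theorem lambert_gram_unique {α β γ v0 v1 v2 : ℝ} (hα : α ≠ 0) (hβ : β ≠ 0) (hγ : γ ≠ 0)
    (e0 : v0 ^ 2 * (γ ^ 2 + v2 ^ 2) = γ ^ 2 * (γ ^ 2 + β ^ 2))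
    (e1 : v1 ^ 2 * (α ^ 2 + v0 ^ 2) = α ^ 2 * (α ^ 2 + γ ^ 2))
    (e2 : v2 ^ 2 * (β ^ 2 + v1 ^ 2) = β ^ 2 * (β ^ 2 + α ^ 2)) :
    v0 ^ 2 = γ ^ 2 ∧ v1 ^ 2 = α ^ 2 ∧ v2 ^ 2 = β ^ 2 := by
  have aux : ∀ A B x y : ℝ, 0 < A → 0 ≤ B → 0 ≤ x → 0 ≤ y → x * (A + y) = A * (A + B) →
      (x < A ↔ B < y) ∧ (A < x ↔ y < B) := by
    intro A B x y hA hB hx hy h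
    refine ⟨⟨fun h1 => ?_, fun h1 => ?_⟩, fun h1 => ?_, fun h1 => ?_⟩ <;> by_contra! h2 <;> nlinarith
  have hα2 : 0 < α ^ 2 := by positivity
  have hβ2 : 0 < β ^ 2 := by positivity
  have hγ2 : 0 < γ ^ 2 := by positivity
  obtain ⟨l0, g0⟩ := aux _ _ _ _ hγ2 hβ2.le (sq_nonneg v0) (sq_nonneg v2) e0
  obtain ⟨l1, g1⟩ := aux _ _ _ _ hα2 hγ2.le (sq_nonneg v1) (sq_nonneg v0) e1
  obtain ⟨l2, g2⟩ := aux _ _ _ _ hβ2 hα2.le (sq_nonneg v2) (sq_nonneg v1) e2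
  have h0 : v0 ^ 2 = γ ^ 2 := by
    rcases lt_trichotomy (v0 ^ 2) (γ ^ 2) with h | h | h
    · have h1 := l0.1 h
      have h2 := g2.1 h1
      have h3 := l1.1 h2
      linarith
    · exact h
    · have h1 := g0.1 h
      have h2 := l2.1 h1
      have h3 := g1.1 h2
      linarith
  rw [h0] at e0 e1
  have h2 : v2 ^ 2 = β ^ 2 := by
    have := mul_left_cancel₀ hγ2.ne' e0
    linarith
  have h1 : v1 ^ 2 = α ^ 2 := mul_right_cancel₀ (by positivity) e1
  exact ⟨h0, h1, h2⟩

theorem IsSphericalCube.inner_eq {a b c : ℝ} (h : IsSphericalCube u P)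
    (hd : ∀ (i : Fin 3) (s t : Bool), dihedralAngle (u (i, s)) (u (i + 1, t)) =
      if s = true ∧ t = false then ![a, b, c] i else Real.pi / 2) (i : Fin 3) (s t : Bool) :
    inner ℝ (u (i, s)) (u (i + 1, t)) =
      if s = true ∧ t = false then -Real.cos (![a, b, c] i) else 0 := by
  have h1 := dihedralAngle_mem_Icc (u (i, s)) (u (i + 1, t))
  rw [(dihedralAngle_eq_iff (h.norm_normal _) (h.norm_normal _) h1.1 h1.2).1 rfl, hd]
  split_ifs <;> simp

set_option maxHeartbeats 1000000 in
/-- A Lambert cube with `cos² a + cos² b + cos² c = 1` has obtuse essential angles, and is congruent to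
the standard one. -/
theorem IsLambertCube.congruent_lambertNormal {a b c : ℝ} (h : IsLambertCube a b c P)
    (h1 : Real.cos a ^ 2 + Real.cos b ^ 2 + Real.cos c ^ 2 = 1) :
    Real.cos a < 0 ∧ Real.cos b < 0 ∧ Real.cos c < 0 ∧
    SphericallyCongruent P (sphericalPolyhedron
      (lambertNormal (-Real.cos a) (-Real.cos b) (-Real.cos c))) := by
  obtain ⟨u, hu, hd⟩ := h
  have hin := hu.inner_eq hd
  obtain ⟨α, hα⟩ : ∃ α, α = -Real.cos a := ⟨_, rfl⟩
  obtain ⟨β, hβ⟩ : ∃ β, β = -Real.cos b := ⟨_, rfl⟩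
  obtain ⟨γ, hγ⟩ : ∃ γ, γ = -Real.cos c := ⟨_, rfl⟩
  have p01 : inner ℝ (u (0, true)) (u (1, true)) = 0 := by simpa using hin 0 true true
  have p12 : inner ℝ (u (1, true)) (u (2, true)) = 0 := by simpa using hin 1 true true
  have p20 : inner ℝ (u (2, true)) (u (0, true)) = 0 := by simpa using hin 2 true true
  have m01 : inner ℝ (u (0, false)) (u (1, false)) = 0 := by simpa using hin 0 false false
  have m12 : inner ℝ (u (1, false)) (u (2, false)) = 0 := by simpa using hin 1 false false
  have m20 : inner ℝ (u (2, false)) (u (0, false)) = 0 := by simpa using hin 2 false false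
  have q01 : inner ℝ (u (0, true)) (u (1, false)) = α := by simpa [hα] using hin 0 true false
  have q12 : inner ℝ (u (1, true)) (u (2, false)) = β := by simpa [hβ] using hin 1 true false
  have q20 : inner ℝ (u (2, true)) (u (0, false)) = γ := by simpa [hγ] using hin 2 true false
  have r01 : inner ℝ (u (0, false)) (u (1, true)) = 0 := by simpa using hin 0 false true
  have r12 : inner ℝ (u (1, false)) (u (2, true)) = 0 := by simpa using hin 1 false true
  have r20 : inner ℝ (u (2, false)) (u (0, true)) = 0 := by simpa using hin 2 false true
  rw [← neg_sq (Real.cos a), ← neg_sq (Real.cos b), ← neg_sq (Real.cos c), ← hα, ← hβ, ← hγ] at h1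
  rw [← neg_pos, ← neg_pos (a := Real.cos b), ← neg_pos (a := Real.cos c), ← hα, ← hβ, ← hγ]
  clear hα hβ hγ hin hd
  have hn := hu.norm_normal
  obtain ⟨n, hnn, hn0, hn1⟩ := hu.exists_vertex (fun _ => false)
  -- The signs make the three `false` facets the coordinate conditions xᵢ ≥ 0, with the vertex n as
  -- last basis vector.
  have horth : Orthonormal ℝ ![-u (0, false), -u (1, false), -u (2, false), n] := by
    rw [orthonormal_iff_ite]
    have hn0' : ∀ i, inner ℝ n (u (i, false)) = 0 := fun i => by rw [real_inner_comm]; exact hn0 i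
    have m10 := m01; have m21 := m12; have m02 := m20
    rw [real_inner_comm] at m10 m21 m02
    intro i j
    fin_cases i <;> fin_cases j <;>
      simp [m01, m12, m20, m10, m21, m02, hn0, hn0', inner_neg_left,
        inner_neg_right, hnn, hn]
  let e := (basisOfOrthonormalOfCardEqFinrank horth (by simp)).toOrthonormalBasis (by simpa using horth)
  have he : ∀ i, e i = ![-u (0, false), -u (1, false), -u (2, false), n] i := by intro i; simp [e]
  have hsum : ∀ x y : EuclideanSpace ℝ (Fin 4), inner ℝ x y =
      inner ℝ x (u (0, false)) * inner ℝ (u (0, false)) y +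
      inner ℝ x (u (1, false)) * inner ℝ (u (1, false)) y +
      inner ℝ x (u (2, false)) * inner ℝ (u (2, false)) y + inner ℝ x n * inner ℝ n y := by
    intro x y
    rw [← e.sum_inner_mul_inner x y, Fin.sum_univ_four]
    simp [he]
  -- The three vertices joined to n by an edge; they supply the signs of α, β, γ.
  obtain ⟨y0, -, hy0, hy0'⟩ := hu.exists_vertex ![true, false, false]
  obtain ⟨y1, -, hy1, hy1'⟩ := hu.exists_vertex ![false, true, false]
  obtain ⟨y2, -, hy2, hy2'⟩ := hu.exists_vertex ![false, false, true]
  simp only [Fin.forall_fin_succ, Fin.forall_fin_zero] at hy0 hy0' hy1 hy1' hy2 hy2' hn1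
  simp at hy0 hy0' hy1 hy1' hy2 hy2' hn1
  have r10 := (real_inner_comm (u (0, false)) (u (1, true))).trans r01
  have r21 := (real_inner_comm (u (1, false)) (u (2, true))).trans r12
  have r02 := (real_inner_comm (u (2, false)) (u (0, true))).trans r20
  have np := fun i => real_inner_comm (u (i, true)) n
  have mp := fun i => real_inner_comm (u (i, true)) (u (i, false))
  have qc01 := real_inner_comm (u (0, true)) (u (1, false))
  have qc12 := real_inner_comm (u (1, true)) (u (2, false))
  have qc20 := real_inner_comm (u (2, true)) (u (0, false))
  obtain ⟨v0, hv0⟩ : ∃ v, inner ℝ (u (0, true)) n = v := ⟨_, rfl⟩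
  obtain ⟨v1, hv1⟩ : ∃ v, inner ℝ (u (1, true)) n = v := ⟨_, rfl⟩
  obtain ⟨v2, hv2⟩ : ∃ v, inner ℝ (u (2, true)) n = v := ⟨_, rfl⟩
  obtain ⟨x0, hx0⟩ : ∃ v, inner ℝ (u (0, true)) (u (0, false)) = v := ⟨_, rfl⟩
  obtain ⟨x1, hx1⟩ : ∃ v, inner ℝ (u (1, true)) (u (1, false)) = v := ⟨_, rfl⟩
  obtain ⟨x2, hx2⟩ : ∃ v, inner ℝ (u (2, true)) (u (2, false)) = v := ⟨_, rfl⟩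
  -- In the frame each `true` normal has only two unknown coordinates, xᵢ and vᵢ: one of the others
  -- is prescribed by the essential angle and one vanishes.
  have hs0 : ∀ x, inner ℝ (u (0, true)) x = x0 * inner ℝ (u (0, false)) x +
      α * inner ℝ (u (1, false)) x + v0 * inner ℝ n x := fun x => by
    rw [hsum, hx0, q01, r02, hv0]; ring
  have hs1 : ∀ x, inner ℝ (u (1, true)) x = x1 * inner ℝ (u (1, false)) x +
      β * inner ℝ (u (2, false)) x + v1 * inner ℝ n x := fun x => by
    rw [hsum, hx1, q12, r10, hv1]; ring
  have hs2 : ∀ x, inner ℝ (u (2, true)) x = γ * inner ℝ (u (0, false)) x +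
      x2 * inner ℝ (u (2, false)) x + v2 * inner ℝ n x := fun x => by
    rw [hsum, hx2, q20, r21, hv2]; ring
  have f01 := hs0 (u (1, true))
  have f12 := hs1 (u (2, true))
  have f20 := hs2 (u (0, true))
  have f00 := hs0 (u (0, true))
  have f11 := hs1 (u (1, true))
  have f22 := hs2 (u (2, true))
  rw [p01, r01, mp, np, hx1, hv1] at f01
  rw [p12, r12, mp, np, hx2, hv2] at f12
  rw [p20, r20, mp, np, hx0, hv0] at f20
  rw [real_inner_self_eq_norm_sq, hn, mp, np, qc01, hx0, q01, hv0] at f00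
  rw [real_inner_self_eq_norm_sq, hn, mp, np, qc12, hx1, q12, hv1] at f11
  rw [real_inner_self_eq_norm_sq, hn, mp, np, qc20, hx2, q20, hv2] at f22
  rw [hv0, hv1, hv2] at hn1
  obtain ⟨n0, n1, n2⟩ := hn1
  obtain ⟨hp0, hm01, hm02⟩ := hy0
  obtain ⟨hm00, hp01, hp02⟩ := hy0'
  have γpos : 0 < γ := by
    have a1 := hs0 y0
    have a2 := hs1 y0
    rw [hm01, hp0] at a1
    rw [hm01, hm02] at a2
    exact lambert_cos_pos (x := x0) (v := v0) (w := v2) (by linarith) n0 n2 (by linarith) hm00 (pos_of_neg_of_mul_neg (v := v1) n1 (by linarith))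
  obtain ⟨hm10, hp1, hm12⟩ := hy1
  obtain ⟨hp10, hm11, hp12⟩ := hy1'
  have αpos : 0 < α := by
    have a1 := hs1 y1
    have a2 := hs2 y1
    rw [hm12, hp1] at a1
    rw [hm10, hm12] at a2
    exact lambert_cos_pos (x := x1) (v := v1) (w := v0) (by linarith) n1 n0 (by linarith) hm11 (pos_of_neg_of_mul_neg (v := v2) n2 (by linarith))
  obtain ⟨hm20, hm21, hp2⟩ := hy2
  obtain ⟨hp20, hp21, hm22⟩ := hy2'
  have βpos : 0 < β := by
    have a1 := hs2 y2
    have a2 := hs0 y2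
    rw [hm20, hp2] at a1
    rw [hm20, hm21] at a2
    exact lambert_cos_pos (x := x2) (v := v2) (w := v1) (by linarith) n2 n1 (by linarith) hm22 (pos_of_neg_of_mul_neg (v := v0) n0 (by linarith))
  -- Eliminating xᵢ between the unit-norm and orthogonality relations, with 1 = α² + β² + γ², leaves
  -- equations in the vᵢ² alone.
  obtain ⟨w0, w1, w2⟩ := lambert_gram_unique (v0 := v0) (v1 := v1) (v2 := v2) αpos.ne' βpos.ne' γpos.ne'
    (by linear_combination -γ ^ 2 * h1 - γ ^ 2 * f00 + (γ * x0 - v2 * v0) * f20)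
    (by linear_combination -α ^ 2 * h1 - α ^ 2 * f11 + (α * x1 - v0 * v1) * f01)
    (by linear_combination -β ^ 2 * h1 - β ^ 2 * f22 + (β * x2 - v1 * v2) * f12)
  obtain rfl := eq_neg_of_neg_of_sq_eq n0 γpos w0
  obtain rfl := eq_neg_of_neg_of_sq_eq n1 αpos w1
  obtain rfl := eq_neg_of_neg_of_sq_eq n2 βpos w2
  obtain rfl : x0 = -β := mul_left_cancel₀ γpos.ne' (by linarith)
  obtain rfl : x1 = -γ := mul_left_cancel₀ αpos.ne' (by linarith)
  obtain rfl : x2 = -α := mul_left_cancel₀ βpos.ne' (by linarith)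
  refine ⟨αpos, βpos, γpos, e.repr, ?_⟩
  have hinner : ∀ f x, inner ℝ (lambertNormal α β γ f) (e.repr x) = inner ℝ (u f) x := by
    rw [forall_cubeFacet]
    simp only [inner_lambertNormal_zero_true, inner_lambertNormal_one_true,
      inner_lambertNormal_two_true, inner_lambertNormal_zero_false, inner_lambertNormal_one_false,
      inner_lambertNormal_two_false, OrthonormalBasis.repr_apply_apply, he, hs0, hs1, hs2]
    simp only [Matrix.cons_val, inner_neg_left, neg_neg, implies_true, and_true]
    refine ⟨fun x => by ring, fun x => by ring, fun x => by ring⟩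
  rw [hu.eq_polyhedron]
  ext y
  constructor
  · rintro ⟨x, ⟨hx, hx'⟩, rfl⟩
    refine ⟨by simpa using hx, fun f => ?_⟩
    rw [hinner]; exact hx' f
  · rintro ⟨hy, hy'⟩
    refine ⟨e.repr.symm y, ⟨by simpa using hy, fun f => ?_⟩, by simp⟩
    rw [← hinner]; simpa using hy' f

end Uniqueness

/-! ### Relabelling the facets and moving by isometries -/

section Symmetry

variable {u : CubeFacet → EuclideanSpace ℝ (Fin 4)} {P Q : Set (EuclideanSpace ℝ (Fin 4))}

theorem sphericalPolyhedron_comp_equiv (e : CubeFacet ≃ CubeFacet) :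
    sphericalPolyhedron (u ∘ e) = sphericalPolyhedron u := by
  ext x
  simp only [sphericalPolyhedron, Set.mem_ofPred_eq, Function.comp_apply]
  rw [e.forall_congr_left]
  simp

theorem sphericalFace_comp_equiv (e : CubeFacet ≃ CubeFacet) (S : Set CubeFacet) :
    sphericalFace (u ∘ e) S = sphericalFace u (e '' S) := by
  ext x
  refine and_congr (by rw [sphericalPolyhedron_comp_equiv]) ?_
  rw [Set.forall_mem_image]
  rfl

theorem IsSphericalCube.relabel (h : IsSphericalCube u P) (σ : Equiv.Perm (Fin 3))
    (τ : Equiv.Perm Bool) : IsSphericalCube (u ∘ σ.prodCongr τ) P where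
  norm_normal f := h.norm_normal _
  eq_polyhedron := by rw [sphericalPolyhedron_comp_equiv, h.eq_polyhedron]
  face_nonempty_iff S := by
    rw [sphericalFace_comp_equiv, h.face_nonempty_iff]
    constructor
    · rintro ⟨ε, hε⟩
      refine ⟨fun i => τ.symm (ε (σ i)), fun f hf => ?_⟩
      rw [τ.symm_apply_eq]
      exact hε _ ⟨f, hf, rfl⟩
    · rintro ⟨ε, hε⟩
      refine ⟨fun i => τ (ε (σ.symm i)), ?_⟩
      rintro _ ⟨f, hf, rfl⟩
      simp [hε f hf]

theorem dihedralAngle_comm (n m : EuclideanSpace ℝ (Fin 4)) :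
    dihedralAngle n m = dihedralAngle m n := by
  rw [dihedralAngle, dihedralAngle, InnerProductGeometry.angle_comm]

theorem IsLambertCube.rotate {a b c : ℝ} (h : IsLambertCube a b c P) : IsLambertCube b c a P := by
  obtain ⟨u, hu, hd⟩ := h
  refine ⟨_, hu.relabel (Equiv.addRight 1) (Equiv.refl _), fun i s t => ?_⟩
  have := hd (i + 1) s t
  simp only [Function.comp_apply, Equiv.prodCongr_apply, Prod.map, Equiv.coe_addRight,
    Equiv.refl_apply]
  rw [this]
  fin_cases i <;> simp

/-- Reversing the indices reverses the cyclic order; exchanging `true` and `false` as well restores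
the pattern of essential edges. -/
theorem IsLambertCube.swap {a b c : ℝ} (h : IsLambertCube a b c P) : IsLambertCube b a c P := by
  obtain ⟨u, hu, hd⟩ := h
  refine ⟨_, hu.relabel Fin.revPerm Equiv.boolNot, fun i s t => ?_⟩
  have := hd (Fin.rev (i + 1)) (!t) (!s)
  rw [show Fin.rev (i + 1) + 1 = Fin.rev i by fin_cases i <;> rfl] at this
  simp only [Function.comp_apply, Equiv.prodCongr_apply, Prod.map, Fin.revPerm_apply,
    Equiv.boolNot_apply]
  rw [dihedralAngle_comm, this]
  fin_cases i <;> cases s <;> cases t <;> simp [Fin.rev]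

/-- `rotate` and `swap` generate all permutations of three angles. -/
theorem IsLambertCube.of_multiset_eq {a b c a' b' c' : ℝ} (h : IsLambertCube a b c P)
    (he : ({a, b, c} : Multiset ℝ) = {a', b', c'}) : IsLambertCube a' b' c' P := by
  have pair : ∀ x y z w : ℝ, ({x, y} : Multiset ℝ) = {z, w} → x = z ∧ y = w ∨ x = w ∧ y = z := by
    intro x y z w h
    have hx : x ∈ ({z, w} : Multiset ℝ) := by rw [← h]; simp
    simp only [Multiset.insert_eq_cons, Multiset.mem_cons, Multiset.mem_singleton] at hx
    rcases hx with rfl | rfl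
    · simp only [Multiset.insert_eq_cons, Multiset.cons_inj_right, Multiset.singleton_inj] at h
      exact Or.inl ⟨rfl, h⟩
    · rw [Multiset.pair_comm z] at h
      simp only [Multiset.insert_eq_cons, Multiset.cons_inj_right, Multiset.singleton_inj] at h
      exact Or.inr ⟨rfl, h⟩
  have rot : ∀ u v w : ℝ, ({u, v, w} : Multiset ℝ) = {v, w, u} := fun u v w => by
    simp only [Multiset.insert_eq_cons, ← Multiset.singleton_add]
    abel
  have ha : a ∈ ({a', b', c'} : Multiset ℝ) := by rw [← he]; simp
  simp only [Multiset.insert_eq_cons, Multiset.mem_cons, Multiset.mem_singleton] at ha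
  rcases ha with rfl | rfl | rfl
  · rcases pair _ _ _ _ ((Multiset.cons_inj_right _).1 he) with ⟨rfl, rfl⟩ | ⟨rfl, rfl⟩
    · exact h
    · exact h.swap.rotate
  · rw [rot a'] at he
    rcases pair _ _ _ _ ((Multiset.cons_inj_right _).1 he) with ⟨rfl, rfl⟩ | ⟨rfl, rfl⟩
    · exact h.rotate.rotate
    · exact h.swap
  · rw [rot a', rot b'] at he
    rcases pair _ _ _ _ ((Multiset.cons_inj_right _).1 he) with ⟨rfl, rfl⟩ | ⟨rfl, rfl⟩
    · exact h.rotate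
    · exact h.swap.rotate.rotate

theorem IsLambertCube.of_congruent {a b c : ℝ} (h : IsLambertCube a b c P)
    (hc : SphericallyCongruent Q P) : IsLambertCube a b c Q := by
  obtain ⟨g, rfl⟩ := hc
  obtain ⟨u, hu, hd⟩ := h
  have hg : ∀ f x, inner ℝ (g.symm (u f)) x = inner ℝ (u f) (g x) := fun f x => by
    rw [← g.inner_map_map, g.apply_symm_apply]
  have hpoly : ∀ x, x ∈ sphericalPolyhedron (fun f => g.symm (u f)) ↔ g x ∈ sphericalPolyhedron u := by
    intro x
    simp [sphericalPolyhedron, hg]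
  refine ⟨fun f => g.symm (u f), ⟨fun f => by simp [hu.norm_normal], ?_, fun S => ?_⟩, ?_⟩
  · ext x
    rw [hpoly, ← hu.eq_polyhedron, g.injective.mem_set_image]
  · rw [← hu.face_nonempty_iff]
    constructor
    · rintro ⟨x, hx, hx'⟩
      exact ⟨g x, (hpoly x).1 hx, fun f hf => by rw [← hg]; exact hx' f hf⟩
    · rintro ⟨x, hx, hx'⟩
      exact ⟨g.symm x, (hpoly _).2 (by simpa using hx), fun f hf => by rw [hg]; simpa using hx' f hf⟩
  · intro i s t
    rw [← hd, dihedralAngle, dihedralAngle]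
    exact congrArg _ (g.symm.toLinearIsometry.angle_map _ _)

end Symmetry

/-! ### Signs and means over circles -/

/-- The sign function with values `1` and `-1`. -/
noncomputable def sgn (x : ℝ) : ℝ := if 0 < x then 1 else -1

theorem sgn_pos {x : ℝ} (h : 0 < x) : sgn x = 1 := if_pos h
theorem sgn_neg {x : ℝ} (h : x ≤ 0) : sgn x = -1 := if_neg h.not_gt

theorem sgn_eq (x : ℝ) : sgn x = 1 ∨ sgn x = -1 := by
  rcases lt_or_ge 0 x with h | h
  · exact Or.inl (sgn_pos h)
  · exact Or.inr (sgn_neg h)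

theorem abs_sgn (x : ℝ) : |sgn x| = 1 := by rcases sgn_eq x with h | h <;> rw [h] <;> simp

theorem sgn_mul_of_pos {r : ℝ} (hr : 0 < r) (x : ℝ) : sgn (r * x) = sgn x := by
  simp only [sgn, mul_pos_iff_of_pos_left hr]

theorem measurable_sgn : Measurable sgn :=
  Measurable.ite measurableSet_Ioi measurable_const measurable_const

section Plane

/-- The mean of a function over the unit circle. -/
noncomputable def circleMean (f : ℝ × ℝ → ℝ) : ℝ :=
  (∫ φ in Set.Ioo (-Real.pi) Real.pi, f (Real.cos φ, Real.sin φ)) / (2 * Real.pi)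

/-- In polar coordinates the integrand splits into an angular and a radial factor; the case f = 1
identifies the radial one. -/
theorem integral_homogeneous_mul_radial {f : ℝ × ℝ → ℝ}
    (hf : ∀ r : ℝ, 0 < r → ∀ x y, f (r * x, r * y) = f (x, y)) (g : ℝ → ℝ) :
    ∫ z : ℝ × ℝ, f z * g (z.1 ^ 2 + z.2 ^ 2) =
      circleMean f * ∫ z : ℝ × ℝ, g (z.1 ^ 2 + z.2 ^ 2) := by
  have key : ∀ f : ℝ × ℝ → ℝ, (∀ r : ℝ, 0 < r → ∀ x y, f (r * x, r * y) = f (x, y)) →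
      ∫ z : ℝ × ℝ, f z * g (z.1 ^ 2 + z.2 ^ 2) =
        (∫ r in Set.Ioi (0 : ℝ), r * g (r ^ 2)) *
          ∫ φ in Set.Ioo (-Real.pi) Real.pi, f (Real.cos φ, Real.sin φ) := by
    intro f hf
    rw [← integral_comp_polarCoord_symm, ← setIntegral_prod_mul]
    refine setIntegral_congr_fun polarCoord.open_target.measurableSet fun p hp => ?_
    have hp1 : 0 < p.1 := hp.1
    simp only [polarCoord_symm_apply, smul_eq_mul, hf _ hp1]
    rw [show (p.1 * Real.cos p.2) ^ 2 + (p.1 * Real.sin p.2) ^ 2 = p.1 ^ 2 by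
      linear_combination p.1 ^ 2 * Real.sin_sq_add_cos_sq p.2]
    ring
  have h1 := key (fun _ => 1) (fun _ _ _ _ => rfl)
  have hp := Real.pi_pos
  have hvol : ∫ _ in Set.Ioo (-Real.pi) Real.pi, (1 : ℝ) = 2 * Real.pi := by
    simp [two_mul, hp.le]
  rw [hvol] at h1
  simp only [one_mul] at h1
  rw [key f hf, h1, circleMean]
  field_simp

/-- Fubini on ℝ² × ℝ²: with one point fixed the integrand is radial in the other up to a homogeneous
factor, and the inner integral is again radial, so the planar lemma applies twice. -/
theorem integral_homogeneous_mul_homogeneous_ball {f h : ℝ × ℝ → ℝ}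
    (hf : ∀ r : ℝ, 0 < r → ∀ x y, f (r * x, r * y) = f (x, y))
    (hh : ∀ r : ℝ, 0 < r → ∀ x y, h (r * x, r * y) = h (x, y))
    (hfm : Measurable f) (hhm : Measurable h) (hfb : ∀ z, |f z| ≤ 1) (hhb : ∀ z, |h z| ≤ 1)
    (g : ℝ → ℝ) (hg : Integrable fun p : (ℝ × ℝ) × (ℝ × ℝ) =>
      g (p.1.1 ^ 2 + p.1.2 ^ 2 + (p.2.1 ^ 2 + p.2.2 ^ 2))) :
    ∫ p : (ℝ × ℝ) × (ℝ × ℝ), f p.1 * h p.2 * g (p.1.1 ^ 2 + p.1.2 ^ 2 + (p.2.1 ^ 2 + p.2.2 ^ 2)) =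
      circleMean f * circleMean h *
        ∫ p : (ℝ × ℝ) × (ℝ × ℝ), g (p.1.1 ^ 2 + p.1.2 ^ 2 + (p.2.1 ^ 2 + p.2.2 ^ 2)) := by
  have hint : Integrable fun p : (ℝ × ℝ) × (ℝ × ℝ) =>
      f p.1 * h p.2 * g (p.1.1 ^ 2 + p.1.2 ^ 2 + (p.2.1 ^ 2 + p.2.2 ^ 2)) := by
    refine hg.bdd_mul (c := 1) (by fun_prop) (Filter.Eventually.of_forall fun p => ?_)
    rw [Real.norm_eq_abs, abs_mul]
    exact mul_le_one₀ (hfb _) (abs_nonneg _) (hhb _)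
  rw [Measure.volume_eq_prod] at hint hg ⊢
  rw [integral_prod _ hint, integral_prod _ hg]
  have h1 : ∀ z : ℝ × ℝ, ∫ w : ℝ × ℝ, f z * h w * g (z.1 ^ 2 + z.2 ^ 2 + (w.1 ^ 2 + w.2 ^ 2)) =
      circleMean h * (f z * ∫ w : ℝ × ℝ, g (z.1 ^ 2 + z.2 ^ 2 + (w.1 ^ 2 + w.2 ^ 2))) := by
    intro z
    simp_rw [mul_assoc]
    rw [integral_const_mul, integral_homogeneous_mul_radial hh (fun s => g (z.1 ^ 2 + z.2 ^ 2 + s))]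
    ring
  simp_rw [h1]
  rw [integral_const_mul,
    integral_homogeneous_mul_radial hf (fun s => ∫ w : ℝ × ℝ, g (s + (w.1 ^ 2 + w.2 ^ 2)))]
  ring

end Plane

theorem circleMean_one : circleMean (fun _ => 1) = 1 := by
  have hp := Real.pi_pos
  simp [circleMean, ← two_mul, hp.le, hp.ne']

theorem circleMean_eq_intervalIntegral (f : ℝ × ℝ → ℝ) :
    circleMean f = (∫ φ in (-Real.pi)..Real.pi, f (Real.cos φ, Real.sin φ)) / (2 * Real.pi) := by
  rw [circleMean, intervalIntegral.integral_of_le (by linarith [Real.pi_pos]),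
    integral_Ioc_eq_integral_Ioo]

theorem intervalIntegral_eq_of_forall_Ioo {f : ℝ → ℝ} {a b c : ℝ} (hab : a ≤ b)
    (h : ∀ x ∈ Set.Ioo a b, f x = c) : ∫ x in a..b, f x = (b - a) * c := by
  rw [intervalIntegral.integral_of_le hab, integral_Ioc_eq_integral_Ioo,
    setIntegral_congr_fun measurableSet_Ioo h]
  simp [hab]

theorem intervalIntegrable_of_abs_le_one {f : ℝ → ℝ} (hf : Measurable f) (h : ∀ x, |f x| ≤ 1)
    (a b : ℝ) : IntervalIntegrable f volume a b :=
  (intervalIntegrable_const (c := (1 : ℝ))).mono_fun hf.aestronglyMeasurable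
    (Filter.Eventually.of_forall fun x => by simpa using h x)

theorem circleMean_eq_of_periodic {f : ℝ × ℝ → ℝ} (t : ℝ) :
    circleMean f = (∫ φ in t..(t + 2 * Real.pi), f (Real.cos φ, Real.sin φ)) / (2 * Real.pi) := by
  rw [circleMean_eq_intervalIntegral]
  have hper : Function.Periodic (fun φ => f (Real.cos φ, Real.sin φ)) (2 * Real.pi) := fun φ => by
    simp only [Real.cos_add_two_pi, Real.sin_add_two_pi]
  rw [← hper.intervalIntegral_add_eq (-Real.pi) t]
  congr 3
  ring

theorem cos_neg_of_lt_of_lt {x : ℝ} (h : -(3 * Real.pi / 2) < x) (h' : x < -(Real.pi / 2)) :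
    Real.cos x < 0 := by
  rw [← Real.cos_neg]
  exact Real.cos_neg_of_pi_div_two_lt_of_lt (by linarith) (by linarith)

theorem circleMean_sgn (θ : ℝ) :
    circleMean (fun z => sgn (Real.cos θ * z.1 + Real.sin θ * z.2)) = 0 := by
  have hp := Real.pi_pos
  rw [circleMean_eq_of_periodic (θ - Real.pi / 2)]
  simp only [← Real.cos_sub θ]
  have hint := intervalIntegrable_of_abs_le_one (f := fun φ => sgn (Real.cos (θ - φ)))
    (measurable_sgn.comp (by fun_prop)) (fun x => (abs_sgn _).le)
  rw [← intervalIntegral.integral_add_adjacent_intervals (hint _ (θ + Real.pi / 2)) (hint _ _),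
    intervalIntegral_eq_of_forall_Ioo (c := 1) (by linarith) fun φ hφ => ?_,
    intervalIntegral_eq_of_forall_Ioo (c := -1) (by linarith) fun φ hφ => ?_]
  · ring
  · exact sgn_neg (cos_neg_of_lt_of_lt (by linarith [hφ.2]) (by linarith [hφ.1])).le
  · exact sgn_pos (Real.cos_pos_of_mem_Ioo ⟨by linarith [hφ.2], by linarith [hφ.1]⟩)

/-- The two half-planes disagree on two arcs of length θ each. -/
theorem circleMean_sgn_mul_sgn {θ : ℝ} (h0 : 0 ≤ θ) (h1 : θ ≤ Real.pi) :
    circleMean (fun z => sgn z.1 * sgn (Real.cos θ * z.1 + Real.sin θ * z.2)) =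
      1 - 2 * (θ / Real.pi) := by
  have hp := Real.pi_pos
  rw [circleMean_eq_of_periodic (-(Real.pi / 2))]
  simp only [← Real.cos_sub]
  have hint := intervalIntegrable_of_abs_le_one
    (f := fun φ => sgn (Real.cos φ) * sgn (Real.cos (θ - φ)))
    ((measurable_sgn.comp (by fun_prop)).mul (measurable_sgn.comp (by fun_prop)))
    (fun x => by rw [abs_mul, abs_sgn, abs_sgn, one_mul])
  -- Starting at -π/2, the sign changes occur in the order θ - π/2, π/2, θ + π/2.
  rw [← intervalIntegral.integral_add_adjacent_intervals (hint _ (θ + Real.pi / 2)) (hint _ _),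
    ← intervalIntegral.integral_add_adjacent_intervals (hint _ (Real.pi / 2)) (hint _ _),
    ← intervalIntegral.integral_add_adjacent_intervals (hint _ (θ - Real.pi / 2)) (hint _ _),
    intervalIntegral_eq_of_forall_Ioo (c := -1) (by linarith) fun φ hφ => ?_,
    intervalIntegral_eq_of_forall_Ioo (c := 1) (by linarith) fun φ hφ => ?_,
    intervalIntegral_eq_of_forall_Ioo (c := -1) (by linarith) fun φ hφ => ?_,
    intervalIntegral_eq_of_forall_Ioo (c := 1) (by linarith) fun φ hφ => ?_]
  · field_simp
    ring
  · rw [sgn_neg (Real.cos_neg_of_pi_div_two_lt_of_lt (by linarith [hφ.1]) (by linarith [hφ.2])).le,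
      sgn_neg (cos_neg_of_lt_of_lt (by linarith [hφ.2]) (by linarith [hφ.1])).le]
    norm_num
  · rw [sgn_neg (Real.cos_neg_of_pi_div_two_lt_of_lt (by linarith [hφ.1]) (by linarith [hφ.2])).le,
      sgn_pos (Real.cos_pos_of_mem_Ioo ⟨by linarith [hφ.2], by linarith [hφ.1]⟩)]
    norm_num
  · rw [sgn_pos (Real.cos_pos_of_mem_Ioo ⟨by linarith [hφ.1], by linarith [hφ.2]⟩),
      sgn_pos (Real.cos_pos_of_mem_Ioo ⟨by linarith [hφ.2], by linarith [hφ.1]⟩)]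
    norm_num
  · rw [sgn_pos (Real.cos_pos_of_mem_Ioo ⟨by linarith [hφ.1], by linarith [hφ.2]⟩),
      sgn_neg (Real.cos_neg_of_pi_div_two_lt_of_lt (by linarith [hφ.2]) (by linarith [hφ.1])).le]
    norm_num

/-! ### Sign correlations over the unit ball of ℝ⁴ -/

/-- Reading off the four coordinates in pairs. -/
theorem measurePreserving_pair_coordinates :
    MeasurePreserving (fun x : EuclideanSpace ℝ (Fin 4) => ((x 0, x 1), (x 2, x 3))) := by
  have h1 := (EuclideanSpace.volume_preserving_symm_measurableEquiv_toLp (Fin 4))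
  have h2 := volume_preserving_piFinSuccAbove (fun _ : Fin 4 => ℝ) 0
  have h3 := volume_preserving_piFinSuccAbove (fun _ : Fin 3 => ℝ) 0
  have h4 := volume_preserving_piFinTwo (fun _ : Fin 2 => ℝ)
  have h5 := ((MeasurePreserving.id (volume : Measure ℝ)).prod
    ((MeasurePreserving.id (volume : Measure ℝ)).prod h4)).comp
    (((MeasurePreserving.id (volume : Measure ℝ)).prod h3).comp (h2.comp h1))
  have h6 := (volume_preserving_prodAssoc (α₁ := ℝ) (β₁ := ℝ) (γ₁ := ℝ × ℝ)).symm
  exact h6.comp h5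

/-- The volume of the unit ball of `ℝ⁴`. -/
theorem volume_real_ball_four :
    (volume : Measure (EuclideanSpace ℝ (Fin 4))).real (Metric.ball 0 1) = Real.pi ^ 2 / 2 := by
  rw [measureReal_def, InnerProductSpace.volume_ball_of_dim_even (k := 2) (by simp)]
  simp
  positivity

/-- The frame splits ℝ⁴ into two orthogonal planes, and the indicator of the ball is a radial
weight; angular functions on the two planes are then independent. -/
theorem integral_ball_frame (e : OrthonormalBasis (Fin 4) ℝ (EuclideanSpace ℝ (Fin 4)))
    {f h : ℝ × ℝ → ℝ} (hf : ∀ r : ℝ, 0 < r → ∀ x y, f (r * x, r * y) = f (x, y))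
    (hh : ∀ r : ℝ, 0 < r → ∀ x y, h (r * x, r * y) = h (x, y))
    (hfm : Measurable f) (hhm : Measurable h) (hfb : ∀ z, |f z| ≤ 1) (hhb : ∀ z, |h z| ≤ 1) :
    ∫ x in Metric.ball (0 : EuclideanSpace ℝ (Fin 4)) 1,
      f (inner ℝ (e 0) x, inner ℝ (e 1) x) * h (inner ℝ (e 2) x, inner ℝ (e 3) x) =
      circleMean f * circleMean h * (Real.pi ^ 2 / 2) := by
  let g : ℝ → ℝ := fun s => if s < 1 then 1 else 0
  have hgm : Measurable g := Measurable.ite measurableSet_Iio measurable_const measurable_const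
  have hmp := measurePreserving_pair_coordinates.comp e.measurePreserving_repr
  have hg : ∀ x : EuclideanSpace ℝ (Fin 4),
      g (e.repr x 0 ^ 2 + e.repr x 1 ^ 2 + (e.repr x 2 ^ 2 + e.repr x 3 ^ 2)) =
        (Metric.ball (0 : EuclideanSpace ℝ (Fin 4)) 1).indicator (fun _ => (1 : ℝ)) x := by
    intro x
    have hn : e.repr x 0 ^ 2 + e.repr x 1 ^ 2 + (e.repr x 2 ^ 2 + e.repr x 3 ^ 2) = ‖x‖ ^ 2 := by
      rw [← e.repr.norm_map x, norm_sq_four]; ring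
    simp only [g, hn, Set.indicator, mem_ball_zero_iff, sq_lt_one_iff₀ (norm_nonneg x)]
  let G : (ℝ × ℝ) × (ℝ × ℝ) → ℝ := fun p => g (p.1.1 ^ 2 + p.1.2 ^ 2 + (p.2.1 ^ 2 + p.2.2 ^ 2))
  have hGm : Measurable G := hgm.comp (by fun_prop)
  have hball : IntegrableOn (fun _ : EuclideanSpace ℝ (Fin 4) => (1 : ℝ)) (Metric.ball 0 1) :=
    integrableOn_const (measure_ball_lt_top.ne)
  have hGi : Integrable G := by
    rw [← hmp.integrable_comp hGm.aestronglyMeasurable]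
    refine (integrable_indicator_iff measurableSet_ball).2 hball |>.congr ?_
    exact Filter.Eventually.of_forall fun x => (hg x).symm
  have tr : ∀ F : (ℝ × ℝ) × (ℝ × ℝ) → ℝ, Measurable F → ∫ p, F p = ∫ x, F ((e.repr x 0, e.repr x 1),
      (e.repr x 2, e.repr x 3)) := fun F hF => by
    rw [← hmp.map_eq, integral_map hmp.measurable.aemeasurable hF.aestronglyMeasurable]
    rfl
  have key := ((tr (fun p => f p.1 * h p.2 * G p)
    (((hfm.comp measurable_fst).mul (hhm.comp measurable_snd)).mul hGm)).symm.trans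
    (integral_homogeneous_mul_homogeneous_ball hf hh hfm hhm hfb hhb g hGi)).trans
    (congrArg _ (tr G hGm))
  simp only [G] at key
  simp only [hg] at key
  simp only [OrthonormalBasis.repr_apply_apply] at key
  rw [integral_indicator measurableSet_ball] at key
  simp only [integral_const, smul_eq_mul, mul_one, MeasurableSet.univ, measureReal_restrict_apply,
    Set.univ_inter, volume_real_ball_four] at key
  rw [← key, ← integral_indicator measurableSet_ball]
  refine integral_congr_ae (Filter.Eventually.of_forall fun x => ?_)
  simp only [Set.indicator]
  split_ifs <;> simp


section Pair

variable {a b c d : EuclideanSpace ℝ (Fin 4)} {θ : ℝ}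

theorem measurable_sgn_inner (v : EuclideanSpace ℝ (Fin 4)) :
    Measurable fun x => sgn (inner ℝ v x) :=
  measurable_sgn.comp (by fun_prop)

theorem integrableOn_ball_of_abs_le_one {F : EuclideanSpace ℝ (Fin 4) → ℝ} (hF : Measurable F)
    (h : ∀ x, |F x| ≤ 1) : IntegrableOn F (Metric.ball 0 1) :=
  Measure.integrableOn_of_bounded (measure_ball_lt_top.ne) hF.aestronglyMeasurable
    (Filter.Eventually.of_forall h)

/-- The correlations of the signs of four linear forms, orthogonal in pairs. -/
theorem integral_ball_sgn_inner (ha : ‖a‖ = 1) (hb : ‖b‖ = 1) (hc : ‖c‖ = 1) (hd : ‖d‖ = 1)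
    (hac : inner ℝ a c = 0) (had : inner ℝ a d = 0) (hbc : inner ℝ b c = 0)
    (hbd : inner ℝ b d = 0) (h0 : 0 < θ) (h1 : θ < Real.pi) (hab : inner ℝ a b = Real.cos θ)
    (hcd : inner ℝ c d = -Real.cos θ) :
    ∫ x in Metric.ball (0 : EuclideanSpace ℝ (Fin 4)) 1,
      (sgn (inner ℝ a x) * sgn (inner ℝ d x) + sgn (inner ℝ c x) * sgn (inner ℝ b x) +
        sgn (inner ℝ a x) * sgn (inner ℝ b x) - sgn (inner ℝ c x) * sgn (inner ℝ d x) +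
        sgn (inner ℝ a x) * sgn (inner ℝ b x) * (sgn (inner ℝ c x) * sgn (inner ℝ d x))) =
      (1 - 4 * (θ / Real.pi) ^ 2) * (Real.pi ^ 2 / 2) := by
  have hs : 0 < Real.sin θ := Real.sin_pos_of_pos_of_lt_pi h0 h1
  have hsc := Real.sin_sq_add_cos_sq θ
  have hba : inner ℝ b a = Real.cos θ := by rw [real_inner_comm, hab]
  have hdc : inner ℝ d c = -Real.cos θ := by rw [real_inner_comm, hcd]
  have haa : inner ℝ a a = (1 : ℝ) := by rw [real_inner_self_eq_norm_sq, ha, one_pow]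
  have hbb : inner ℝ b b = (1 : ℝ) := by rw [real_inner_self_eq_norm_sq, hb, one_pow]
  have hcc : inner ℝ c c = (1 : ℝ) := by rw [real_inner_self_eq_norm_sq, hc, one_pow]
  have hdd : inner ℝ d d = (1 : ℝ) := by rw [real_inner_self_eq_norm_sq, hd, one_pow]
  have hca : inner ℝ c a = 0 := by rw [real_inner_comm, hac]
  have hda : inner ℝ d a = 0 := by rw [real_inner_comm, had]
  have hcb : inner ℝ c b = 0 := by rw [real_inner_comm, hbc]
  have hdb : inner ℝ d b = 0 := by rw [real_inner_comm, hbd]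
  -- Gram–Schmidt in the planes of a, b and of c, d; the latter two make the angle π - θ.
  obtain ⟨p, hp⟩ : ∃ p, p = (Real.sin θ)⁻¹ • (b - Real.cos θ • a) := ⟨_, rfl⟩
  obtain ⟨q, hq⟩ : ∃ q, q = (Real.sin θ)⁻¹ • (d + Real.cos θ • c) := ⟨_, rfl⟩
  have hpp : ‖p‖ = 1 := by
    rw [← sq_eq_sq₀ (norm_nonneg _) zero_le_one, ← real_inner_self_eq_norm_sq, hp]
    simp only [inner_smul_left, inner_smul_right, inner_sub_left, inner_sub_right, haa, hbb, hab, hba,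
      conj_trivial]
    field_simp
    linarith
  have hqq : ‖q‖ = 1 := by
    rw [← sq_eq_sq₀ (norm_nonneg _) zero_le_one, ← real_inner_self_eq_norm_sq, hq]
    simp only [inner_smul_left, inner_smul_right, inner_add_left, inner_add_right, hcc, hdd, hcd, hdc,
      conj_trivial]
    field_simp
    linarith
  have hap : inner ℝ a p = 0 := by simp [hp, inner_smul_right, inner_sub_right, hab, ha]
  have hcq : inner ℝ c q = 0 := by simp [hq, inner_smul_right, inner_add_right, hcd, hc]
  have hcp : inner ℝ c p = 0 := by simp [hp, inner_smul_right, inner_sub_right, hcb, hca]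
  have haq : inner ℝ a q = 0 := by simp [hq, inner_smul_right, inner_add_right, had, hac]
  have hpq : inner ℝ p q = 0 := by
    simp [hp, hq, inner_smul_left, inner_smul_right, inner_sub_left, inner_add_right, had, hac, hbc, hbd]
  have hpa := (real_inner_comm a p).trans hap
  have hqc := (real_inner_comm c q).trans hcq
  have hpc := (real_inner_comm c p).trans hcp
  have hqa := (real_inner_comm a q).trans haq
  have hqp := (real_inner_comm p q).trans hpq
  have horth : Orthonormal ℝ ![a, p, c, q] := by
    rw [orthonormal_iff_ite]
    intro i j
    fin_cases i <;> fin_cases j <;>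
      simp [ha, hc, hpp, hqq, hap, hcq, hcp, haq, hpq, hpa, hqc, hpc, hqa, hqp, hac, hca]
  let e := (basisOfOrthonormalOfCardEqFinrank horth (by simp)).toOrthonormalBasis (by simpa using horth)
  have he : ∀ i, e i = ![a, p, c, q] i := by intro i; simp [e]
  have ea : ∀ x, inner ℝ (e 0) x = inner ℝ a x := fun x => by rw [he]; rfl
  have ec : ∀ x, inner ℝ (e 2) x = inner ℝ c x := fun x => by rw [he]; rfl
  have ep : e 1 = p := he 1
  have eq : e 3 = q := he 3
  have eb : ∀ x, Real.cos θ * inner ℝ a x + Real.sin θ * inner ℝ (e 1) x = inner ℝ b x := by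
    intro x
    rw [ep, hp]
    simp only [inner_smul_left, inner_sub_left, conj_trivial]
    field_simp
    ring
  have ed : ∀ x, Real.cos (Real.pi - θ) * inner ℝ c x + Real.sin (Real.pi - θ) * inner ℝ (e 3) x =
      inner ℝ d x := by
    intro x
    rw [eq, hq, Real.cos_pi_sub, Real.sin_pi_sub]
    simp only [inner_smul_left, inner_add_left, conj_trivial]
    field_simp
    ring
  let s1 : ℝ × ℝ → ℝ := fun z => sgn z.1
  let s2 : ℝ → ℝ × ℝ → ℝ := fun θ z => sgn (Real.cos θ * z.1 + Real.sin θ * z.2)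
  have hs1 : ∀ r : ℝ, 0 < r → ∀ x y, s1 (r * x, r * y) = s1 (x, y) := fun r hr x y => sgn_mul_of_pos hr x
  have hs2 : ∀ θ, ∀ r : ℝ, 0 < r → ∀ x y, s2 θ (r * x, r * y) = s2 θ (x, y) := fun θ r hr x y => by
    simp only [s2]
    rw [← sgn_mul_of_pos hr (Real.cos θ * x + _)]
    ring_nf
  have ms1 : Measurable s1 := measurable_sgn.comp measurable_fst
  have ms2 : ∀ θ, Measurable (s2 θ) := fun θ => measurable_sgn.comp (by fun_prop)
  have hs12 : ∀ θ, ∀ r : ℝ, 0 < r → ∀ x y, (s1 * s2 θ) (r * x, r * y) = (s1 * s2 θ) (x, y) :=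
    fun θ r hr x y => by simp only [Pi.mul_apply, hs1 r hr, hs2 θ r hr]
  have b1 : ∀ z, |s1 z| ≤ 1 := fun z => (abs_sgn _).le
  have b2 : ∀ θ z, |s2 θ z| ≤ 1 := fun θ z => (abs_sgn _).le
  have b12 : ∀ θ z, |(s1 * s2 θ) z| ≤ 1 := fun θ z => by
    rw [Pi.mul_apply, abs_mul]; exact mul_le_one₀ (b1 z) (abs_nonneg _) (b2 θ z)
  have c1 : circleMean s1 = 0 := by simpa [s1] using circleMean_sgn 0
  have c2 : ∀ θ, circleMean (s2 θ) = 0 := circleMean_sgn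
  have c12 : ∀ θ, 0 ≤ θ → θ ≤ Real.pi → circleMean (s1 * s2 θ) = 1 - 2 * (θ / Real.pi) :=
    fun θ => circleMean_sgn_mul_sgn
  have hone : ∀ r : ℝ, 0 < r → ∀ x y, (fun _ : ℝ × ℝ => (1 : ℝ)) (r * x, r * y) =
    (fun _ : ℝ × ℝ => (1 : ℝ)) (x, y) := fun _ _ _ _ => rfl
  have bone : ∀ z : ℝ × ℝ, |(fun _ : ℝ × ℝ => (1 : ℝ)) z| ≤ 1 := fun _ => by simp
  have I1 := integral_ball_frame e hs1 (hs2 (Real.pi - θ)) ms1 (ms2 _) b1 (b2 _)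
  have I2 := integral_ball_frame e (hs2 θ) hs1 (ms2 _) ms1 (b2 _) b1
  have I3 := integral_ball_frame e (hs12 θ) hone (ms1.mul (ms2 _)) measurable_const (b12 _) bone
  have I4 := integral_ball_frame e hone (hs12 (Real.pi - θ)) measurable_const (ms1.mul (ms2 _)) bone
    (b12 _)
  have I5 := integral_ball_frame e (hs12 θ) (hs12 (Real.pi - θ)) (ms1.mul (ms2 _)) (ms1.mul (ms2 _))
    (b12 _) (b12 _)
  rw [c1, zero_mul, zero_mul] at I1
  rw [c2, zero_mul, zero_mul] at I2
  rw [c12 _ h0.le h1.le, circleMean_one] at I3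
  rw [c12 _ (by linarith) (by linarith), circleMean_one] at I4
  rw [c12 _ h0.le h1.le, c12 _ (by linarith) (by linarith)] at I5
  simp only [s1, s2, Pi.mul_apply, ea, ec, eb, ed, mul_one, one_mul] at I1 I2 I3 I4 I5
  have m := measurable_sgn_inner
  have ib : ∀ v w, IntegrableOn (fun x => sgn (inner ℝ v x) * sgn (inner ℝ w x))
      (Metric.ball (0 : EuclideanSpace ℝ (Fin 4)) 1) := fun v w =>
    integrableOn_ball_of_abs_le_one ((m v).mul (m w))
      (fun x => by simp only [abs_mul, abs_sgn, mul_one, le_refl])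
  have ib4 : IntegrableOn (fun x => sgn (inner ℝ a x) * sgn (inner ℝ b x) *
      (sgn (inner ℝ c x) * sgn (inner ℝ d x))) (Metric.ball (0 : EuclideanSpace ℝ (Fin 4)) 1) :=
    integrableOn_ball_of_abs_le_one (((m a).mul (m b)).mul ((m c).mul (m d)))
      (fun x => by simp only [abs_mul, abs_sgn, mul_one, le_refl])
  have I2' : ∫ x in Metric.ball (0 : EuclideanSpace ℝ (Fin 4)) 1,
      sgn (inner ℝ c x) * sgn (inner ℝ b x) = 0 :=
    (integral_congr_ae (Filter.Eventually.of_forall fun x => mul_comm _ _)).trans I2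
  have j1 : IntegrableOn (fun x => sgn (inner ℝ a x) * sgn (inner ℝ d x) +
      sgn (inner ℝ c x) * sgn (inner ℝ b x)) (Metric.ball 0 1) := (ib a d).add (ib c b)
  have j2 : IntegrableOn (fun x => sgn (inner ℝ a x) * sgn (inner ℝ d x) +
      sgn (inner ℝ c x) * sgn (inner ℝ b x) + sgn (inner ℝ a x) * sgn (inner ℝ b x))
      (Metric.ball 0 1) := j1.add (ib a b)
  have j3 : IntegrableOn (fun x => sgn (inner ℝ a x) * sgn (inner ℝ d x) +
      sgn (inner ℝ c x) * sgn (inner ℝ b x) + sgn (inner ℝ a x) * sgn (inner ℝ b x) -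
      sgn (inner ℝ c x) * sgn (inner ℝ d x)) (Metric.ball 0 1) := j2.sub (ib c d)
  -- With m = 1 - 2θ/π the means are 0, 0, m, -m and -m², so the total factor is 2m - m² = 1 -
  -- 4(θ/π)².
  rw [integral_add j3 ib4, integral_sub j2 (ib c d), integral_add j1 (ib a b),
    integral_add (ib a d) (ib c b), I1, I2', I3, I4, I5]
  field_simp
  ring

end Pair

/-! ### Combinatorics of the six signs -/

/-- The product of the indicators of `s i = 1`, for signs `s i`. -/
noncomputable def octant (s0 s1 s2 t0 t1 t2 : ℝ) : ℝ :=
  (1 + s0) / 2 * ((1 + s1) / 2) * ((1 + s2) / 2) * ((1 + t0) / 2) * ((1 + t1) / 2) * ((1 + t2) / 2)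

/-- Under the sign hypotheses all terms on the left have the sign of A. At A ≤ 0 the term in B is
strictly positive before subtraction, but only E ≤ 0 is needed since `sgn` is -1 at 0. -/
theorem sgn_eq_of_relation {k1 k2 k3 k4 k5 A B C D E : ℝ} (h1 : 0 < k1) (h2 : 0 < k2) (h3 : 0 < k3)
    (h4 : 0 < k4) (h5 : 0 < k5) (h : k1 * A - k2 * B + k3 * C + k4 * D = k5 * E)
    (hB : sgn B = -sgn A) (hC : sgn C = sgn A) (hD : sgn D = sgn A) : sgn E = sgn A := by
  have pos : ∀ {x : ℝ}, sgn x = 1 → 0 < x := fun {x} hx => by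
    by_contra hn
    rw [sgn_neg (not_lt.1 hn)] at hx
    norm_num at hx
  have neg : ∀ {x : ℝ}, sgn x = -1 → x ≤ 0 := fun {x} hx => by
    by_contra hn
    rw [sgn_pos (not_le.1 hn)] at hx
    norm_num at hx
  rcases sgn_eq A with hA | hA <;> rw [hA] at hB hC hD ⊢
  · have a := mul_pos h1 (pos hA)
    have b := mul_nonneg h2.le (neg_nonneg.2 (neg hB))
    have c := mul_pos h3 (pos hC)
    have d := mul_pos h4 (pos hD)
    exact sgn_pos (pos_of_mul_pos_right (by linarith : 0 < k5 * E) h5.le)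
  · rw [neg_neg] at hB
    have a := mul_nonneg h1.le (neg_nonneg.2 (neg hA))
    have b := mul_pos h2 (pos hB)
    have c := mul_nonneg h3.le (neg_nonneg.2 (neg hC))
    have d := mul_nonneg h4.le (neg_nonneg.2 (neg hD))
    exact sgn_neg (nonpos_of_mul_nonpos_right (by linarith : k5 * E ≤ 0) h5)

/-- Six signs that avoid the patterns excluded by the linear relations between the facet normals lie
in a common quadrant if and only if a sum of pairwise terms does not vanish. -/
theorem octant_sum_eq {s0 s1 s2 t0 t1 t2 : ℝ} (hs0 : s0 = 1 ∨ s0 = -1) (hs1 : s1 = 1 ∨ s1 = -1)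
    (hs2 : s2 = 1 ∨ s2 = -1) (ht0 : t0 = 1 ∨ t0 = -1) (ht1 : t1 = 1 ∨ t1 = -1)
    (ht2 : t2 = 1 ∨ t2 = -1)
    (h1 : t0 = -t2 → s0 = t2 → s2 = t2 → s1 = t2)
    (h2 : t1 = -t0 → s1 = t0 → s0 = t0 → s2 = t0)
    (h3 : t2 = -t1 → s2 = t1 → s1 = t1 → s0 = t1) :
    octant s0 s1 s2 t0 t1 t2 + octant t0 t1 t2 (-s0) (-s1) (-s2) +
      octant (-s0) (-s1) (-s2) (-t0) (-t1) (-t2) + octant (-t0) (-t1) (-t2) s0 s1 s2 =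
    -(1 / 8) + 1 / 8 * ((s0 * s1 + t0 * t1 + s0 * t1 - t0 * s1 + s0 * t1 * (t0 * s1)) +
      (s1 * s2 + t1 * t2 + s1 * t2 - t1 * s2 + s1 * t2 * (t1 * s2)) +
      (s2 * s0 + t2 * t0 + s2 * t0 - t2 * s0 + s2 * t0 * (t2 * s0))) := by
  -- Read (sᵢ, tᵢ) as a quadrant, numbered counterclockwise modulo 4. Each cyclic bracket is 3 - 2m,
  -- where m ∈ {0, 1, 2, 3} is the step to the next quadrant. The three steps sum to 0, 4 or 8; the
  -- hypotheses exclude 8, so the right side is 1 when all quadrants agree and 0 otherwise, as is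
  -- the left.
  unfold octant
  rcases hs0 with rfl | rfl <;> rcases hs1 with rfl | rfl <;> rcases hs2 with rfl | rfl <;>
    rcases ht0 with rfl | rfl <;> rcases ht1 with rfl | rfl <;> rcases ht2 with rfl | rfl <;>
    first
    | (norm_num; done)
    | (refine absurd (h1 ?_ ?_ ?_) ?_ <;> norm_num; done)
    | (refine absurd (h2 ?_ ?_ ?_) ?_ <;> norm_num; done)
    | (refine absurd (h3 ?_ ?_ ?_) ?_ <;> norm_num; done)

/-! ### Quaternionic rotation and the volume of the cone -/

section Volume

variable (α β γ : ℝ)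

theorem norm_rotation_sq (h1 : α ^ 2 + β ^ 2 + γ ^ 2 = 1) (x : EuclideanSpace ℝ (Fin 4)) :
    ‖!₂[α * x 3 - γ * x 1 + β * x 2, β * x 3 - α * x 2 + γ * x 0, γ * x 3 - β * x 0 + α * x 1,
      -(α * x 0 + β * x 1 + γ * x 2)]‖ = ‖x‖ := by
  rw [← sq_eq_sq₀ (norm_nonneg _) (norm_nonneg _), norm_sq_four, norm_sq_four]
  simp
  linear_combination (x 0 ^ 2 + x 1 ^ 2 + x 2 ^ 2 + x 3 ^ 2) * h1

/-- Multiplication by the imaginary unit quaternion `α i + β j + γ k`, as an isometry. -/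
noncomputable def lambertRotation (h1 : α ^ 2 + β ^ 2 + γ ^ 2 = 1) :
    EuclideanSpace ℝ (Fin 4) ≃ₗᵢ[ℝ] EuclideanSpace ℝ (Fin 4) :=
  LinearIsometry.toLinearIsometryEquiv
    { toFun := fun x => !₂[α * x 3 - γ * x 1 + β * x 2, β * x 3 - α * x 2 + γ * x 0,
        γ * x 3 - β * x 0 + α * x 1, -(α * x 0 + β * x 1 + γ * x 2)]
      map_add' := fun x y => by
        ext i
        fin_cases i <;> simp <;> ring
      map_smul' := fun r x => by
        ext i
        fin_cases i <;> simp <;> ring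
      norm_map' := norm_rotation_sq α β γ h1 } rfl

theorem lambertRotation_apply (h1 : α ^ 2 + β ^ 2 + γ ^ 2 = 1) (x : EuclideanSpace ℝ (Fin 4)) :
    lambertRotation α β γ h1 x = !₂[α * x 3 - γ * x 1 + β * x 2, β * x 3 - α * x 2 + γ * x 0,
      γ * x 3 - β * x 0 + α * x 1, -(α * x 0 + β * x 1 + γ * x 2)] := rfl

/-- The octant function at the signs of the six linear forms that bound the standard Lambert cube. -/
noncomputable def lambertOctant (x : EuclideanSpace ℝ (Fin 4)) : ℝ :=
  octant (sgn (x 0)) (sgn (x 1)) (sgn (x 2)) (sgn (α * x 3 - γ * x 1 + β * x 2))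
    (sgn (β * x 3 - α * x 2 + γ * x 0)) (sgn (γ * x 3 - β * x 0 + α * x 1))

/-- As J² = -1, rotation replaces the forms of x by those of Jx, and the latter by minus the
coordinates of x. -/
theorem lambertOctant_rotation (h1 : α ^ 2 + β ^ 2 + γ ^ 2 = 1) (x : EuclideanSpace ℝ (Fin 4)) :
    lambertOctant α β γ (lambertRotation α β γ h1 x) =
      octant (sgn (α * x 3 - γ * x 1 + β * x 2)) (sgn (β * x 3 - α * x 2 + γ * x 0))
        (sgn (γ * x 3 - β * x 0 + α * x 1)) (sgn (-x 0)) (sgn (-x 1)) (sgn (-x 2)) := by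
  rw [lambertOctant, lambertRotation_apply]
  simp
  congr 2
  · linear_combination (-x 0) * h1
  · linear_combination (-x 1) * h1
  · linear_combination (-x 2) * h1

theorem integral_ball_comp_isometry (g : EuclideanSpace ℝ (Fin 4) ≃ₗᵢ[ℝ] EuclideanSpace ℝ (Fin 4))
    (F : EuclideanSpace ℝ (Fin 4) → ℝ) :
    ∫ x in Metric.ball (0 : EuclideanSpace ℝ (Fin 4)) 1, F (g x) =
      ∫ x in Metric.ball (0 : EuclideanSpace ℝ (Fin 4)) 1, F x := by
  have h := g.measurePreserving.setIntegral_preimage_emb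
    g.toHomeomorph.measurableEmbedding F (Metric.ball 0 1)
  rw [← h]
  congr 2
  ext x
  simp

theorem ae_inner_ne_zero {v : EuclideanSpace ℝ (Fin 4)} (hv : v ≠ 0) :
    ∀ᵐ x : EuclideanSpace ℝ (Fin 4), inner ℝ v x ≠ 0 := by
  have h := Measure.addHaar_submodule (volume : Measure (EuclideanSpace ℝ (Fin 4)))
    (LinearMap.ker (innerSL ℝ v).toLinearMap) (fun h => hv (by
      have : v ∈ LinearMap.ker (innerSL ℝ v).toLinearMap := by rw [h]; trivial
      simpa using this))
  rw [ae_iff]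
  convert h using 2
  ext x
  simp

theorem measurable_lambertOctant : Measurable (lambertOctant α β γ) := by
  have m0 : Measurable fun x : EuclideanSpace ℝ (Fin 4) => sgn (x 0) := measurable_sgn.comp (by fun_prop)
  have m1 : Measurable fun x : EuclideanSpace ℝ (Fin 4) => sgn (x 1) := measurable_sgn.comp (by fun_prop)
  have m2 : Measurable fun x : EuclideanSpace ℝ (Fin 4) => sgn (x 2) := measurable_sgn.comp (by fun_prop)
  have n0 : Measurable fun x : EuclideanSpace ℝ (Fin 4) => sgn (α * x 3 - γ * x 1 + β * x 2) :=
    measurable_sgn.comp (by fun_prop)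
  have n1 : Measurable fun x : EuclideanSpace ℝ (Fin 4) => sgn (β * x 3 - α * x 2 + γ * x 0) :=
    measurable_sgn.comp (by fun_prop)
  have n2 : Measurable fun x : EuclideanSpace ℝ (Fin 4) => sgn (γ * x 3 - β * x 0 + α * x 1) :=
    measurable_sgn.comp (by fun_prop)
  unfold lambertOctant octant
  fun_prop

theorem lambertOctant_eq (x : EuclideanSpace ℝ (Fin 4)) : lambertOctant α β γ x =
    if 0 < x 0 ∧ 0 < x 1 ∧ 0 < x 2 ∧ 0 < α * x 3 - γ * x 1 + β * x 2 ∧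
      0 < β * x 3 - α * x 2 + γ * x 0 ∧ 0 < γ * x 3 - β * x 0 + α * x 1 then 1 else 0 := by
  have h : ∀ t : ℝ, (1 + sgn t) / 2 = if 0 < t then 1 else 0 := fun t => by
    unfold sgn
    split_ifs <;> norm_num
  simp only [lambertOctant, octant, h, mul_ite, mul_one, mul_zero]
  split_ifs <;> tauto

variable {α β γ}

theorem ae_lambert_forms_ne_zero (hα : 0 < α) (hβ : 0 < β) :
    ∀ᵐ x : EuclideanSpace ℝ (Fin 4), (x 0 ≠ 0 ∧ x 1 ≠ 0 ∧ x 2 ≠ 0) ∧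
      α * x 3 - γ * x 1 + β * x 2 ≠ 0 ∧ β * x 3 - α * x 2 + γ * x 0 ≠ 0 ∧
      γ * x 3 - β * x 0 + α * x 1 ≠ 0 := by
  have key : ∀ a b c d : ℝ, (a ≠ 0 ∨ b ≠ 0 ∨ c ≠ 0 ∨ d ≠ 0) →
      ∀ᵐ x : EuclideanSpace ℝ (Fin 4), a * x 0 + b * x 1 + c * x 2 + d * x 3 ≠ 0 := by
    intro a b c d h
    have hv : !₂[a, b, c, d] ≠ (0 : EuclideanSpace ℝ (Fin 4)) := by
      intro h0
      have e0 := congrArg (fun y : EuclideanSpace ℝ (Fin 4) => y 0) h0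
      have e1 := congrArg (fun y : EuclideanSpace ℝ (Fin 4) => y 1) h0
      have e2 := congrArg (fun y : EuclideanSpace ℝ (Fin 4) => y 2) h0
      have e3 := congrArg (fun y : EuclideanSpace ℝ (Fin 4) => y 3) h0
      simp at e0 e1 e2 e3
      tauto
    filter_upwards [ae_inner_ne_zero hv] with x hx
    rwa [inner_vec_four] at hx
  filter_upwards [key 1 0 0 0 (by simp), key 0 1 0 0 (by simp), key 0 0 1 0 (by simp),
    key 0 (-γ) β α (by simp [hα.ne']), key γ 0 (-α) β (by simp [hβ.ne']),
    key (-β) α 0 γ (by simp [hβ.ne'])] with x h0 h1 h2 h3 h4 h5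
  refine ⟨⟨by simpa using h0, by simpa using h1, by simpa using h2⟩, ?_, ?_, ?_⟩
  · convert h3 using 1; ring
  · convert h4 using 1; ring
  · convert h5 using 1; ring

/-- The sum of the octant function over the four images of a point under the rotation. -/
theorem ae_lambertOctant_sum (hα : 0 < α) (hβ : 0 < β) (h1 : α ^ 2 + β ^ 2 + γ ^ 2 = 1) :
    ∀ᵐ x : EuclideanSpace ℝ (Fin 4), lambertOctant α β γ x +
      lambertOctant α β γ (lambertRotation α β γ h1 x) +
      lambertOctant α β γ (lambertRotation α β γ h1 (lambertRotation α β γ h1 x)) +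
      lambertOctant α β γ (lambertRotation α β γ h1 (lambertRotation α β γ h1
        (lambertRotation α β γ h1 x))) =
      octant (sgn (x 0)) (sgn (x 1)) (sgn (x 2)) (sgn (α * x 3 - γ * x 1 + β * x 2))
        (sgn (β * x 3 - α * x 2 + γ * x 0)) (sgn (γ * x 3 - β * x 0 + α * x 1)) +
      octant (sgn (α * x 3 - γ * x 1 + β * x 2)) (sgn (β * x 3 - α * x 2 + γ * x 0))
        (sgn (γ * x 3 - β * x 0 + α * x 1)) (-sgn (x 0)) (-sgn (x 1)) (-sgn (x 2)) +
      octant (-sgn (x 0)) (-sgn (x 1)) (-sgn (x 2)) (-sgn (α * x 3 - γ * x 1 + β * x 2))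
        (-sgn (β * x 3 - α * x 2 + γ * x 0)) (-sgn (γ * x 3 - β * x 0 + α * x 1)) +
      octant (-sgn (α * x 3 - γ * x 1 + β * x 2)) (-sgn (β * x 3 - α * x 2 + γ * x 0))
        (-sgn (γ * x 3 - β * x 0 + α * x 1)) (sgn (x 0)) (sgn (x 1)) (sgn (x 2)) := by
  -- Oddness of `sgn` fails at 0, whence the restriction to almost every point.
  have sgn_neg' : ∀ {t : ℝ}, t ≠ 0 → sgn (-t) = -sgn t := fun {t} h => by
    rcases lt_or_gt_of_ne h with h | h
    · rw [sgn_pos (neg_pos.2 h), sgn_neg h.le, neg_neg]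
    · rw [sgn_neg (by linarith), sgn_pos h]
  filter_upwards [ae_lambert_forms_ne_zero (γ := γ) hα hβ] with x hx
  obtain ⟨⟨z0, z1, z2⟩, y0, y1, y2⟩ := hx
  have hJJ : lambertRotation α β γ h1 (lambertRotation α β γ h1 x) = -x := by
    ext i
    rw [lambertRotation_apply, lambertRotation_apply]
    fin_cases i <;> simp
    · linear_combination (-x 0) * h1
    · linear_combination (-x 1) * h1
    · linear_combination (-x 2) * h1
    · linear_combination (-x 3) * h1
  have e0 : α * (-x).ofLp 3 - γ * (-x).ofLp 1 + β * (-x).ofLp 2 =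
    -(α * x 3 - γ * x 1 + β * x 2) := by simp; ring
  have e1 : β * (-x).ofLp 3 - α * (-x).ofLp 2 + γ * (-x).ofLp 0 =
    -(β * x 3 - α * x 2 + γ * x 0) := by simp; ring
  have e2 : γ * (-x).ofLp 3 - β * (-x).ofLp 0 + α * (-x).ofLp 1 =
    -(γ * x 3 - β * x 0 + α * x 1) := by simp; ring
  rw [hJJ, lambertOctant_rotation, lambertOctant_rotation, lambertOctant, lambertOctant, e0, e1, e2,
    sgn_neg' y0, sgn_neg' y1, sgn_neg' y2]
  simp only [PiLp.neg_apply, neg_neg, sgn_neg' z0, sgn_neg' z1, sgn_neg' z2]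

/-- The volume of the part of the unit ball in the cone over the standard Lambert cube. -/
theorem integral_lambertOctant {A B C : ℝ} (hA : 0 < A) (hA' : A < Real.pi) (hB : 0 < B)
    (hB' : B < Real.pi) (hC : 0 < C) (hC' : C < Real.pi) (eA : Real.cos A = α)
    (eB : Real.cos B = β) (eC : Real.cos C = γ) (hα : 0 < α) (hβ : 0 < β) (hγ : 0 < γ)
    (h1 : α ^ 2 + β ^ 2 + γ ^ 2 = 1) :
    ∫ x in Metric.ball (0 : EuclideanSpace ℝ (Fin 4)) 1, lambertOctant α β γ x =
      (Real.pi ^ 2 / 2 - A ^ 2 - B ^ 2 - C ^ 2) / 16 := by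
  obtain ⟨z0, hz0⟩ : ∃ v : EuclideanSpace ℝ (Fin 4), v = !₂[1, 0, 0, 0] := ⟨_, rfl⟩
  obtain ⟨z1, hz1⟩ : ∃ v : EuclideanSpace ℝ (Fin 4), v = !₂[0, 1, 0, 0] := ⟨_, rfl⟩
  obtain ⟨z2, hz2⟩ : ∃ v : EuclideanSpace ℝ (Fin 4), v = !₂[0, 0, 1, 0] := ⟨_, rfl⟩
  obtain ⟨y0, hy0⟩ : ∃ v : EuclideanSpace ℝ (Fin 4), v = !₂[0, -γ, β, α] := ⟨_, rfl⟩
  obtain ⟨y1, hy1⟩ : ∃ v : EuclideanSpace ℝ (Fin 4), v = !₂[γ, 0, -α, β] := ⟨_, rfl⟩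
  obtain ⟨y2, hy2⟩ : ∃ v : EuclideanSpace ℝ (Fin 4), v = !₂[-β, α, 0, γ] := ⟨_, rfl⟩
  have fz0 : ∀ x, inner ℝ z0 x = x 0 := fun x => by rw [hz0, inner_vec_four]; ring
  have fz1 : ∀ x, inner ℝ z1 x = x 1 := fun x => by rw [hz1, inner_vec_four]; ring
  have fz2 : ∀ x, inner ℝ z2 x = x 2 := fun x => by rw [hz2, inner_vec_four]; ring
  have fy0 : ∀ x, inner ℝ y0 x = α * x 3 - γ * x 1 + β * x 2 := fun x => by
    rw [hy0, inner_vec_four]; ring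
  have fy1 : ∀ x, inner ℝ y1 x = β * x 3 - α * x 2 + γ * x 0 := fun x => by
    rw [hy1, inner_vec_four]; ring
  have fy2 : ∀ x, inner ℝ y2 x = γ * x 3 - β * x 0 + α * x 1 := fun x => by
    rw [hy2, inner_vec_four]; ring
  have unit : ∀ v : EuclideanSpace ℝ (Fin 4), v 0 ^ 2 + v 1 ^ 2 + v 2 ^ 2 + v 3 ^ 2 = 1 → ‖v‖ = 1 := by
    intro v hv
    rw [← sq_eq_sq₀ (norm_nonneg _) zero_le_one, norm_sq_four, hv, one_pow]
  have nz0 : ‖z0‖ = 1 := unit _ (by simp [hz0])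
  have nz1 : ‖z1‖ = 1 := unit _ (by simp [hz1])
  have nz2 : ‖z2‖ = 1 := unit _ (by simp [hz2])
  have ny0 : ‖y0‖ = 1 := unit _ (by simp [hy0]; linarith)
  have ny1 : ‖y1‖ = 1 := unit _ (by simp [hy1]; linarith)
  have ny2 : ‖y2‖ = 1 := unit _ (by simp [hy2]; linarith)
  -- For each cyclic pair i, i + 1 the plane of zᵢ, yᵢ₊₁ is orthogonal to that of yᵢ, zᵢ₊₁, and the
  -- two inner products are opposite.
  have I0 := integral_ball_sgn_inner (a := z0) (b := y1) (c := y0) (d := z1) nz0 ny1 ny0 nz1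
    (by simp [fz0, hy0]) (by simp [fz0, hz1]) (by simp [fy1, hy0]; ring) (by simp [fy1, hz1]) hC hC'
    (by simp [fz0, hy1, eC]) (by simp [fy0, hz1, eC])
  have I1 := integral_ball_sgn_inner (a := z1) (b := y2) (c := y1) (d := z2) nz1 ny2 ny1 nz2
    (by simp [fz1, hy1]) (by simp [fz1, hz2]) (by simp [fy2, hy1]; ring) (by simp [fy2, hz2]) hA hA'
    (by simp [fz1, hy2, eA]) (by simp [fy1, hz2, eA])
  have I2 := integral_ball_sgn_inner (a := z2) (b := y0) (c := y2) (d := z0) nz2 ny0 ny2 nz0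
    (by simp [fz2, hy2]) (by simp [fz2, hz0]) (by simp [fy0, hy2]; ring) (by simp [fy0, hz0]) hB hB'
    (by simp [fz2, hy0, eB]) (by simp [fy2, hz0, eB])
  have m := measurable_sgn_inner
  have ib : ∀ v w, IntegrableOn (fun x => sgn (inner ℝ v x) * sgn (inner ℝ w x))
      (Metric.ball (0 : EuclideanSpace ℝ (Fin 4)) 1) := fun v w =>
    integrableOn_ball_of_abs_le_one ((m v).mul (m w))
      (fun x => by simp only [abs_mul, abs_sgn, mul_one, le_refl])
  have ib4 : ∀ a b c d, IntegrableOn (fun x => sgn (inner ℝ a x) * sgn (inner ℝ b x) *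
      (sgn (inner ℝ c x) * sgn (inner ℝ d x))) (Metric.ball (0 : EuclideanSpace ℝ (Fin 4)) 1) :=
    fun a b c d => integrableOn_ball_of_abs_le_one (((m a).mul (m b)).mul ((m c).mul (m d)))
      (fun x => by simp only [abs_mul, abs_sgn, mul_one, le_refl])
  have iq : ∀ a b c d, IntegrableOn (fun x => sgn (inner ℝ a x) * sgn (inner ℝ d x) +
        sgn (inner ℝ c x) * sgn (inner ℝ b x) +
        sgn (inner ℝ a x) * sgn (inner ℝ b x) - sgn (inner ℝ c x) * sgn (inner ℝ d x) +
        sgn (inner ℝ a x) * sgn (inner ℝ b x) * (sgn (inner ℝ c x) * sgn (inner ℝ d x)))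
      (Metric.ball (0 : EuclideanSpace ℝ (Fin 4)) 1) := fun a b c d =>
    ((((ib a d).add (ib c b)).add (ib a b)).sub (ib c d)).add (ib4 a b c d)
  have hsum : ∀ᵐ x : EuclideanSpace ℝ (Fin 4), lambertOctant α β γ x +
      lambertOctant α β γ (lambertRotation α β γ h1 x) +
      lambertOctant α β γ (lambertRotation α β γ h1 (lambertRotation α β γ h1 x)) +
      lambertOctant α β γ (lambertRotation α β γ h1 (lambertRotation α β γ h1
        (lambertRotation α β γ h1 x))) = -(1 / 8) + 1 / 8 *
      ((sgn (inner ℝ z0 x) * sgn (inner ℝ z1 x) + sgn (inner ℝ y0 x) * sgn (inner ℝ y1 x) +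
        sgn (inner ℝ z0 x) * sgn (inner ℝ y1 x) - sgn (inner ℝ y0 x) * sgn (inner ℝ z1 x) +
        sgn (inner ℝ z0 x) * sgn (inner ℝ y1 x) * (sgn (inner ℝ y0 x) * sgn (inner ℝ z1 x))) +
      (sgn (inner ℝ z1 x) * sgn (inner ℝ z2 x) + sgn (inner ℝ y1 x) * sgn (inner ℝ y2 x) +
        sgn (inner ℝ z1 x) * sgn (inner ℝ y2 x) - sgn (inner ℝ y1 x) * sgn (inner ℝ z2 x) +
        sgn (inner ℝ z1 x) * sgn (inner ℝ y2 x) * (sgn (inner ℝ y1 x) * sgn (inner ℝ z2 x))) +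
      (sgn (inner ℝ z2 x) * sgn (inner ℝ z0 x) + sgn (inner ℝ y2 x) * sgn (inner ℝ y0 x) +
        sgn (inner ℝ z2 x) * sgn (inner ℝ y0 x) - sgn (inner ℝ y2 x) * sgn (inner ℝ z0 x) +
        sgn (inner ℝ z2 x) * sgn (inner ℝ y0 x) * (sgn (inner ℝ y2 x) * sgn (inner ℝ z0 x)))) := by
    filter_upwards [ae_lambertOctant_sum hα hβ h1] with x hx
    rw [hx]
    simp only [fz0, fz1, fz2, fy0, fy1, fy2]
    have pαβ := mul_pos hα hβ
    have pαγ := mul_pos hα hγ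
    have pβγ := mul_pos hβ hγ
    have qαβ : 0 < α ^ 2 + β ^ 2 := by positivity
    have qαγ : 0 < α ^ 2 + γ ^ 2 := by positivity
    have qβγ : 0 < β ^ 2 + γ ^ 2 := by positivity
    -- The excluded patterns contradict linear relations such as αy₂ - γy₀ + αβz₀ + βγz₂ = (α² +
    -- γ²)z₁ and its cyclic images.
    apply octant_sum_eq <;> try exact sgn_eq _
    · exact sgn_eq_of_relation hα hγ pαβ pβγ qαγ (by ring)
    · exact sgn_eq_of_relation hβ hα pβγ pαγ qαβ (by ring)
    · exact sgn_eq_of_relation hγ hβ pαγ pαβ qβγ (by ring)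
  let J := lambertRotation α β γ h1
  have io : ∀ g : EuclideanSpace ℝ (Fin 4) ≃ₗᵢ[ℝ] EuclideanSpace ℝ (Fin 4),
      IntegrableOn (fun x => lambertOctant α β γ (g x)) (Metric.ball 0 1) := fun g =>
    integrableOn_ball_of_abs_le_one ((measurable_lambertOctant α β γ).comp g.continuous.measurable)
      (fun x => by rw [lambertOctant_eq]; split_ifs <;> simp)
  -- J preserves the ball, so the orbit sum integrates to four times the wanted integral.
  have key := integral_congr_ae (ae_restrict_of_ae (s := Metric.ball 0 1) hsum)
  have i0 := io (LinearIsometryEquiv.refl ℝ _)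
  have i1 := io J
  have i2 := io (J.trans J)
  have i3 := io ((J.trans J).trans J)
  have c1 := integral_ball_comp_isometry J (lambertOctant α β γ)
  have c2 := integral_ball_comp_isometry (J.trans J) (lambertOctant α β γ)
  have c3 := integral_ball_comp_isometry ((J.trans J).trans J) (lambertOctant α β γ)
  simp only [LinearIsometryEquiv.coe_refl, id_eq, LinearIsometryEquiv.coe_trans,
    Function.comp_apply] at i0 i1 i2 i3 c1 c2 c3
  have i01 : IntegrableOn (fun x => lambertOctant α β γ x + lambertOctant α β γ (J x))
    (Metric.ball 0 1) := i0.add i1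
  have i012 : IntegrableOn (fun x => lambertOctant α β γ x + lambertOctant α β γ (J x) +
    lambertOctant α β γ (J (J x))) (Metric.ball 0 1) := i01.add i2
  have cst : IntegrableOn (fun _ : EuclideanSpace ℝ (Fin 4) => -(1 / 8 : ℝ)) (Metric.ball 0 1) :=
    integrableOn_const (measure_ball_lt_top.ne)
  rw [integral_add i012 i3, integral_add i01 i2, integral_add i0 i1, c1, c2, c3,
    integral_add cst, integral_const_mul, integral_add, integral_add (iq _ _ _ _) (iq _ _ _ _),
    I0, I1, I2] at key
  · simp only [integral_const, smul_eq_mul, MeasurableSet.univ, measureReal_restrict_apply,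
      Set.univ_inter, volume_real_ball_four] at key
    have hp := Real.pi_pos
    field_simp at key ⊢
    linarith
  · exact (iq _ _ _ _).add (iq _ _ _ _)
  · exact iq _ _ _ _
  · exact (((iq _ _ _ _).add (iq _ _ _ _)).add (iq _ _ _ _)).const_mul _

end Volume

/-! ### From cone volume to spherical volume -/

section SphericalVolume

open scoped Pointwise

theorem measurableSet_sphericalPolyhedron (u : CubeFacet → EuclideanSpace ℝ (Fin 4)) :
    MeasurableSet (sphericalPolyhedron u) := by
  have : sphericalPolyhedron u = Metric.sphere 0 1 ∩ ⋂ f, {x | inner ℝ (u f) x ≤ 0} := by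
    ext x
    simp [sphericalPolyhedron]
  rw [this]
  refine Metric.isClosed_sphere.measurableSet.inter (MeasurableSet.iInter fun f => ?_)
  exact measurableSet_le (by fun_prop) measurable_const

theorem sphericalVolume_eq {P : Set (EuclideanSpace ℝ (Fin 4))} (hP : MeasurableSet P)
    (hs : P ⊆ Metric.sphere 0 1) :
    sphericalVolume P = 4 * volume (Set.Ioo (0 : ℝ) 1 • P) := by
  rw [sphericalVolume, Measure.toSphere_apply' _ (measurable_subtype_coe hP),
    Subtype.image_preimage_coe, Set.inter_eq_right.2 hs]
  simp

theorem sphericalVolume_lambertNormal {a b c : ℝ} (ha : 0 < a) (ha' : a < Real.pi) (hb : 0 < b)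
    (hb' : b < Real.pi) (hc : 0 < c) (hc' : c < Real.pi)
    (hca : Real.cos a < 0) (hcb : Real.cos b < 0) (hcc : Real.cos c < 0)
    (h1 : Real.cos a ^ 2 + Real.cos b ^ 2 + Real.cos c ^ 2 = 1) :
    sphericalVolume (sphericalPolyhedron
      (lambertNormal (-Real.cos a) (-Real.cos b) (-Real.cos c))) =
    ENNReal.ofReal ((Real.pi ^ 2 / 2 - (Real.pi - a) ^ 2 - (Real.pi - b) ^ 2 - (Real.pi - c) ^ 2) / 4) := by
  have hI := integral_lambertOctant (A := Real.pi - a) (B := Real.pi - b) (C := Real.pi - c)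
    (by linarith) (by linarith) (by linarith) (by linarith) (by linarith) (by linarith)
    (Real.cos_pi_sub a) (Real.cos_pi_sub b) (Real.cos_pi_sub c) (neg_pos.2 hca) (neg_pos.2 hcb)
    (neg_pos.2 hcc) (by simpa using h1)
  have hα := neg_pos.2 hca
  have hβ := neg_pos.2 hcb
  generalize -Real.cos a = α at *
  generalize -Real.cos b = β at *
  generalize -Real.cos c = γ at *
  rw [sphericalVolume_eq (measurableSet_sphericalPolyhedron _) (fun x hx => hx.1)]
  let S : Set (EuclideanSpace ℝ (Fin 4)) := {x | 0 < x 0 ∧ 0 < x 1 ∧ 0 < x 2 ∧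
    0 < α * x 3 - γ * x 1 + β * x 2 ∧ 0 < β * x 3 - α * x 2 + γ * x 0 ∧
    0 < γ * x 3 - β * x 0 + α * x 1}
  have hS : MeasurableSet S := by
    have : S = lambertOctant α β γ ⁻¹' {1} := by
      ext x
      simp only [Set.mem_preimage, Set.mem_singleton_iff, lambertOctant_eq]
      split_ifs with h
      · simpa [S] using h
      · simpa [S] using h
    rw [this]
    exact measurable_lambertOctant α β γ (measurableSet_singleton 1)
  have hvol : volume.real (Metric.ball 0 1 ∩ S) =
      (Real.pi ^ 2 / 2 - (Real.pi - a) ^ 2 - (Real.pi - b) ^ 2 - (Real.pi - c) ^ 2) / 16 := by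
    rw [← hI, show lambertOctant α β γ = S.indicator 1 from funext fun x => by
      rw [lambertOctant_eq]
      by_cases h : x ∈ S
      · rw [Set.indicator_of_mem h]; exact if_pos h
      · rw [Set.indicator_of_notMem h]; exact if_neg h,
      integral_indicator_one hS, measureReal_restrict_apply hS, Set.inter_comm]
  -- The cone and the open region differ only on the six bounding hyperplanes, a null set.
  have hae : (Set.Ioo (0 : ℝ) 1 • sphericalPolyhedron (lambertNormal α β γ)) =ᵐ[volume]
      (Metric.ball 0 1 ∩ S : Set (EuclideanSpace ℝ (Fin 4))) := by
    rw [Filter.eventuallyEq_set]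
    filter_upwards [ae_lambert_forms_ne_zero (γ := γ) hα hβ] with x hx
    obtain ⟨⟨z0, z1, z2⟩, y0, y1, y2⟩ := hx
    constructor
    · rintro ⟨r, ⟨hr0, hr1⟩, p, ⟨hp, hle⟩, rfl⟩
      obtain ⟨⟨p0, p1, p2⟩, q0, q1, q2⟩ := forall_inner_lambertNormal_nonpos.1 hle
      simp only [PiLp.smul_apply, smul_eq_mul] at *
      refine ⟨?_, ?_⟩
      · rw [mem_ball_zero_iff, norm_smul, mem_sphere_zero_iff_norm.1 hp, mul_one, Real.norm_eq_abs,
          abs_of_pos hr0]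
        exact hr1
      · have n0 := mul_nonneg hr0.le q0
        have n1 := mul_nonneg hr0.le q1
        have n2 := mul_nonneg hr0.le q2
        have m0 := mul_nonneg hr0.le (neg_nonneg.2 p0)
        have m1 := mul_nonneg hr0.le (neg_nonneg.2 p1)
        have m2 := mul_nonneg hr0.le (neg_nonneg.2 p2)
        exact ⟨lt_of_le_of_ne n0 z0.symm, lt_of_le_of_ne n1 z1.symm, lt_of_le_of_ne n2 z2.symm,
          lt_of_le_of_ne (by simp; linarith) y0.symm, lt_of_le_of_ne (by simp; linarith) y1.symm,
          lt_of_le_of_ne (by simp; linarith) y2.symm⟩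
    · rintro ⟨hb, s0, s1, s2, t0, t1, t2⟩
      have hne : x ≠ 0 := by rintro rfl; simp at z0
      have hn := norm_pos_iff.2 hne
      refine ⟨‖x‖, ⟨hn, mem_ball_zero_iff.1 hb⟩, ‖x‖⁻¹ • x, ⟨?_, fun f => ?_⟩, ?_⟩
      · simp [norm_smul, hn.ne']
      · rw [inner_smul_right]
        refine mul_nonpos_of_nonneg_of_nonpos (by positivity) ?_
        revert f
        rw [forall_inner_lambertNormal_nonpos]
        refine ⟨⟨?_, ?_, ?_⟩, s0.le, s1.le, s2.le⟩ <;> linarith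
      · simp [smul_smul, hn.ne']
  rw [measure_congr hae, ← ofReal_measureReal (ne_top_of_le_ne_top measure_ball_lt_top.ne
    (measure_mono Set.inter_subset_left)), hvol, show (4 : ENNReal) = ENNReal.ofReal 4 by simp,
    ← ENNReal.ofReal_mul (by norm_num)]
  congr 1
  ring

theorem SphericallyCongruent.sphericalVolume_eq {P Q : Set (EuclideanSpace ℝ (Fin 4))}
    (hP : MeasurableSet P) (hs : P ⊆ Metric.sphere 0 1) (h : SphericallyCongruent P Q) :
    sphericalVolume P = sphericalVolume Q := by
  obtain ⟨g, rfl⟩ := h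
  have him : g '' P = g.symm ⁻¹' P := g.toEquiv.image_eq_preimage_symm P
  rw [_root_.sphericalVolume_eq hP hs, _root_.sphericalVolume_eq (by
    rw [him]; exact g.symm.continuous.measurable hP) (by
    rintro _ ⟨x, hx, rfl⟩; simpa using hs hx)]
  have : Set.Ioo (0 : ℝ) 1 • (g '' P) = g '' (Set.Ioo (0 : ℝ) 1 • P) := by
    ext y
    simp [Set.mem_smul, Set.mem_image]
  rw [this]
  congr 1
  have him' : g '' (Set.Ioo (0 : ℝ) 1 • P) = g.symm ⁻¹' (Set.Ioo (0 : ℝ) 1 • P) :=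
    g.toEquiv.image_eq_preimage_symm _
  rw [him']
  exact (g.symm.measurePreserving.measure_preimage_emb g.symm.toHomeomorph.measurableEmbedding _).symm

end SphericalVolume

/-! ### Continuous families and the final classification -/

/-- Rational angles are dense and F is closed, so the whole interval maps into F; a connected subset
of a finite set has at most one point. -/
theorem eq_of_continuousOn_of_finite {γ : ℝ → ℝ × ℝ × ℝ} {t₀ t₁ : ℝ} (ht : t₀ < t₁)
    (hγ : ContinuousOn γ (Set.Icc t₀ t₁)) {F : Set (ℝ × ℝ × ℝ)} (hF : F.Finite)
    (h : ∀ t ∈ Set.Icc t₀ t₁, IsRationalAngle t → γ t ∈ F) :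
    ∀ t ∈ Set.Icc t₀ t₁, γ t = γ t₀ := by
  have hdense : Dense {t : ℝ | IsRationalAngle t} := by
    have hp := Real.pi_pos
    have h1 : DenseRange (fun q : ℚ => (q : ℝ) * Real.pi) :=
      (Homeomorph.mulRight₀ Real.pi hp.ne').surjective.denseRange.comp Rat.denseRange_cast
        (Homeomorph.mulRight₀ Real.pi hp.ne').continuous
    refine h1.mono ?_
    rintro _ ⟨q, rfl⟩
    exact ⟨q, rfl⟩
  have hmem : ∀ t ∈ Set.Icc t₀ t₁, γ t ∈ F := by
    have hcl : closure (Set.Ioo t₀ t₁ ∩ {t : ℝ | IsRationalAngle t}) = Set.Icc t₀ t₁ := by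
      rw [← closure_Ioo ht.ne]
      exact (closure_mono Set.inter_subset_left).antisymm
        (closure_minimal (hdense.open_subset_closure_inter isOpen_Ioo) isClosed_closure)
    have hmaps : Set.MapsTo γ (Set.Ioo t₀ t₁ ∩ {t : ℝ | IsRationalAngle t}) F :=
      fun t ht => h t (Set.Ioo_subset_Icc_self ht.1) ht.2
    have := hmaps.closure_of_continuousOn (by rwa [hcl])
    rwa [hcl, hF.isClosed.closure_eq] at this
  have himg : (γ '' Set.Icc t₀ t₁).Subsingleton := by
    by_contra hn
    exact (isPreconnected_Icc.image γ hγ).infinite_of_nontrivial (Set.not_subsingleton_iff.1 hn)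
      (hF.subset (Set.image_subset_iff.2 hmem))
  exact fun t htt => himg ⟨t, htt, rfl⟩ ⟨t₀, ⟨le_rfl, ht.le⟩, rfl⟩

theorem finite_setOf_multiset_eq (a b c : ℝ) :
    {p : ℝ × ℝ × ℝ | ({p.1, p.2.1, p.2.2} : Multiset ℝ) = {a, b, c}}.Finite := by
  have hfin : ({a, b, c} : Set ℝ).Finite := Set.toFinite _
  refine (hfin.prod (hfin.prod hfin)).subset ?_
  rintro ⟨x, y, z⟩ h
  have hm : ∀ w, w ∈ ({x, y, z} : Multiset ℝ) → w ∈ ({a, b, c} : Set ℝ) := fun w hw => by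
    rw [show ({x, y, z} : Multiset ℝ) = {a, b, c} from h] at hw
    simpa using hw
  exact ⟨hm x (by simp), hm y (by simp), hm z (by simp)⟩

theorem angle_lt_pi_of_mem {a b c : ℝ} (hb : Real.cos b < 0)
    (h1 : Real.cos a ^ 2 + Real.cos b ^ 2 + Real.cos c ^ 2 = 1) (ha' : a ≤ Real.pi) : a < Real.pi := by
  refine lt_of_le_of_ne ha' ?_
  rintro rfl
  rw [Real.cos_pi] at h1
  nlinarith [sq_nonneg (Real.cos c)]

/-- Dihedral angles lie in [0, π] and cos a < 0; a = π would force cos b = 0. The other two angles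
follow by `rotate`. -/
theorem IsLambertCube.obtuse {a b c : ℝ} {P : Set (EuclideanSpace ℝ (Fin 4))}
    (h : IsLambertCube a b c P) (h1 : Real.cos a ^ 2 + Real.cos b ^ 2 + Real.cos c ^ 2 = 1) :
    Real.pi / 2 < a ∧ a < Real.pi := by
  obtain ⟨ha, hb, -, -⟩ := h.congruent_lambertNormal h1
  obtain ⟨u, -, hd⟩ := h
  have ha01 := dihedralAngle_mem_Icc (u (0, true)) (u (0 + 1, false))
  rw [hd 0 true false] at ha01
  simp only [and_self, if_true, Matrix.cons_val_zero] at ha01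
  refine ⟨?_, angle_lt_pi_of_mem hb h1 ha01.2⟩
  by_contra hn
  exact absurd (Real.cos_nonneg_of_mem_Icc ⟨by linarith [Real.pi_pos], not_lt.1 hn⟩) ha.not_ge

theorem IsRationalPythagoreanLambertCube.multiset_eq {a b c : ℝ}
    {P : Set (EuclideanSpace ℝ (Fin 4))} (h : IsRationalPythagoreanLambertCube a b c P) :
    ({a, b, c} : Multiset ℝ) = {3 * Real.pi / 4, 2 * Real.pi / 3, 2 * Real.pi / 3} ∨
    ({a, b, c} : Multiset ℝ) = {2 * Real.pi / 3, 3 * Real.pi / 5, 4 * Real.pi / 5} := by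
  obtain ⟨hL, ha, hb, hc, h1⟩ := h
  obtain ⟨a0, a1⟩ := hL.obtuse h1
  obtain ⟨b0, b1⟩ := hL.rotate.obtuse (by linarith)
  obtain ⟨c0, c1⟩ := hL.rotate.rotate.obtuse (by linarith)
  exact obtuse_rational_angles_eq ha hb hc a0 a1 b0 b1 c0 c1 h1

theorem cos_sq_sum_first : Real.cos (3 * Real.pi / 4) ^ 2 + Real.cos (2 * Real.pi / 3) ^ 2 +
    Real.cos (2 * Real.pi / 3) ^ 2 = 1 := by
  rw [cos_three_pi_div_four, cos_two_pi_div_three]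
  have : √2 ^ 2 = 2 := Real.sq_sqrt (by norm_num)
  linear_combination this / 4

theorem cos_sq_sum_second : Real.cos (2 * Real.pi / 3) ^ 2 + Real.cos (3 * Real.pi / 5) ^ 2 +
    Real.cos (4 * Real.pi / 5) ^ 2 = 1 := by
  rw [cos_three_pi_div_five, cos_two_pi_div_three, cos_four_pi_div_five]
  have : √5 ^ 2 = 5 := Real.sq_sqrt (by norm_num)
  linear_combination this / 8

theorem isRationalPythagoreanLambertCube_of_multiset_eq {a b c a' b' c' : ℝ}
    {P Q : Set (EuclideanSpace ℝ (Fin 4))} (h : IsRationalPythagoreanLambertCube a' b' c' Q)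
    (he : ({a, b, c} : Multiset ℝ) = {a', b', c'}) (hc : SphericallyCongruent P Q) :
    IsRationalPythagoreanLambertCube a b c P := by
  obtain ⟨hL, ha, hb, hc', h1⟩ := h
  have hall : ∀ w, w ∈ ({a, b, c} : Multiset ℝ) → IsRationalAngle w := fun w hw => by
    rw [he] at hw
    simp only [Multiset.insert_eq_cons, Multiset.mem_cons, Multiset.mem_singleton] at hw
    rcases hw with rfl | rfl | rfl <;> assumption
  refine ⟨(hL.of_congruent hc).of_multiset_eq he.symm, hall a (by simp), hall b (by simp),
    hall c (by simp), ?_⟩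
  have := congrArg (fun s : Multiset ℝ => (s.map fun x => Real.cos x ^ 2).sum) he
  simp at this
  linarith

theorem mainTheorem3 :
    -- there are exactly two such cubes up to isometry
    (∃ L₁ L₂ : Set (EuclideanSpace ℝ (Fin 4)),
      IsRationalPythagoreanLambertCube
        (3 * Real.pi / 4) (2 * Real.pi / 3) (2 * Real.pi / 3) L₁ ∧
      IsRationalPythagoreanLambertCube
        (2 * Real.pi / 3) (3 * Real.pi / 5) (4 * Real.pi / 5) L₂ ∧
      ¬ SphericallyCongruent L₁ L₂ ∧
      (∀ (a b c : ℝ) (P : Set (EuclideanSpace ℝ (Fin 4))),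
        IsRationalPythagoreanLambertCube a b c P ↔
          (({a, b, c} : Multiset ℝ) =
              {3 * Real.pi / 4, 2 * Real.pi / 3, 2 * Real.pi / 3} ∧
            SphericallyCongruent P L₁) ∨
          (({a, b, c} : Multiset ℝ) =
              {2 * Real.pi / 3, 3 * Real.pi / 5, 4 * Real.pi / 5} ∧
            SphericallyCongruent P L₂)) ∧
      sphericalVolume L₁ = ENNReal.ofReal (31 * Real.pi ^ 2 / 576) ∧
      sphericalVolume L₂ = ENNReal.ofReal (17 * Real.pi ^ 2 / 360)) ∧
    -- there is no nonconstant continuous family of them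
    (∀ (γ : ℝ → ℝ × ℝ × ℝ) (t₀ t₁ : ℝ), t₀ < t₁ → ContinuousOn γ (Set.Icc t₀ t₁) →
      (∀ t ∈ Set.Icc t₀ t₁, IsRationalAngle t →
        ∃ P, IsRationalPythagoreanLambertCube (γ t).1 (γ t).2.1 (γ t).2.2 P) →
      ∀ t ∈ Set.Icc t₀ t₁, γ t = γ t₀) := by
  have hp := Real.pi_pos
  have neg : ∀ x, Real.pi / 2 < x → x < Real.pi → Real.cos x < 0 := fun x h h' =>
    Real.cos_neg_of_pi_div_two_lt_of_lt h (by linarith)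
  have n34 := neg (3 * Real.pi / 4) (by linarith) (by linarith)
  have n23 := neg (2 * Real.pi / 3) (by linarith) (by linarith)
  have n35 := neg (3 * Real.pi / 5) (by linarith) (by linarith)
  have n45 := neg (4 * Real.pi / 5) (by linarith) (by linarith)
  have r34 : IsRationalAngle (3 * Real.pi / 4) := ⟨3 / 4, by push_cast; ring⟩
  have r23 : IsRationalAngle (2 * Real.pi / 3) := ⟨2 / 3, by push_cast; ring⟩
  have r35 : IsRationalAngle (3 * Real.pi / 5) := ⟨3 / 5, by push_cast; ring⟩
  have r45 : IsRationalAngle (4 * Real.pi / 5) := ⟨4 / 5, by push_cast; ring⟩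
  have L1 := isLambertCube_lambertNormal (a := 3 * Real.pi / 4) (b := 2 * Real.pi / 3)
    (c := 2 * Real.pi / 3) (by linarith) (by linarith) (by linarith) (by linarith) (by linarith)
    (by linarith) n34 n23 n23 cos_sq_sum_first
  have L2 := isLambertCube_lambertNormal (a := 2 * Real.pi / 3) (b := 3 * Real.pi / 5)
    (c := 4 * Real.pi / 5) (by linarith) (by linarith) (by linarith) (by linarith) (by linarith)
    (by linarith) n23 n35 n45 cos_sq_sum_second
  have V1 := sphericalVolume_lambertNormal (a := 3 * Real.pi / 4) (b := 2 * Real.pi / 3)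
    (c := 2 * Real.pi / 3) (by linarith) (by linarith) (by linarith) (by linarith) (by linarith)
    (by linarith) n34 n23 n23 cos_sq_sum_first
  have V2 := sphericalVolume_lambertNormal (a := 2 * Real.pi / 3) (b := 3 * Real.pi / 5)
    (c := 4 * Real.pi / 5) (by linarith) (by linarith) (by linarith) (by linarith) (by linarith)
    (by linarith) n23 n35 n45 cos_sq_sum_second
  rw [show (Real.pi ^ 2 / 2 - (Real.pi - 3 * Real.pi / 4) ^ 2 - (Real.pi - 2 * Real.pi / 3) ^ 2 -
    (Real.pi - 2 * Real.pi / 3) ^ 2) / 4 = 31 * Real.pi ^ 2 / 576 by ring] at V1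
  rw [show (Real.pi ^ 2 / 2 - (Real.pi - 2 * Real.pi / 3) ^ 2 - (Real.pi - 3 * Real.pi / 5) ^ 2 -
    (Real.pi - 4 * Real.pi / 5) ^ 2) / 4 = 17 * Real.pi ^ 2 / 360 by ring] at V2
  have R1 : IsRationalPythagoreanLambertCube _ _ _ _ := ⟨L1, r34, r23, r23, cos_sq_sum_first⟩
  have R2 : IsRationalPythagoreanLambertCube _ _ _ _ := ⟨L2, r23, r35, r45, cos_sq_sum_second⟩
  refine ⟨⟨_, _, R1, R2, fun hc => ?_, fun a b c P => ⟨fun h => ?_, ?_⟩, V1, V2⟩, ?_⟩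
  -- The cubes are told apart by volume: 31/576 ≠ 17/360.
  · have := hc.sphericalVolume_eq (measurableSet_sphericalPolyhedron _) (fun x hx => hx.1)
    rw [V1, V2, ENNReal.ofReal_eq_ofReal_iff (by positivity) (by positivity)] at this
    nlinarith [sq_pos_of_pos hp]
  · rcases h.multiset_eq with he | he
    · exact Or.inl ⟨he, ((h.1.of_multiset_eq he).congruent_lambertNormal cos_sq_sum_first).2.2.2⟩
    · exact Or.inr ⟨he, ((h.1.of_multiset_eq he).congruent_lambertNormal cos_sq_sum_second).2.2.2⟩
  · rintro (⟨he, hc⟩ | ⟨he, hc⟩)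
    · exact isRationalPythagoreanLambertCube_of_multiset_eq R1 he hc
    · exact isRationalPythagoreanLambertCube_of_multiset_eq R2 he hc
  · intro γ t₀ t₁ ht hγ h
    refine eq_of_continuousOn_of_finite ht hγ
      ((finite_setOf_multiset_eq (3 * Real.pi / 4) (2 * Real.pi / 3) (2 * Real.pi / 3)).union
        (finite_setOf_multiset_eq (2 * Real.pi / 3) (3 * Real.pi / 5) (4 * Real.pi / 5)))
      fun t htt hr => ?_
    obtain ⟨P, hP⟩ := h t htt hr
    exact hP.multiset_eq
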